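/- **Setting.** Let $\mathcal A$ be a finite alphabet with $\#\mathcal A\ge 2$ letters. Combinatorial data on $\mathcal A$ are pairs $\pi=(\pi_t,\pi_b)$ of bijections $\mathcal A\to\{1,\dots,\#\mathcal A\}$, viewed as a top and a bottom row of letters; $\pi$ is irreducible if for no $1\le k<\#\mathcal A$ the sets of the first $k$ letters of the two rows coincide. Let $\alpha$, $\beta$ be the last letters of the top and bottom row. The top operation moves $\beta$, in the bottom row, to the position immediately to the right of $\alpha$ (winner $\alpha$, loser $\beta$); the bottom operation moves $\alpha$, in the top row, to the position immediately to the right of $\beta$ (winner $\beta$, loser $\alpha$). A Rauzy class $\mathfrak R$ is a minimal non-empty set of irreducible data invariant under both operations. Its Rauzy diagram has vertex set $\mathfrak R$ and, for every vertex and each of the two operations, one arrow from the vertex to its image; $\Pi(\mathfrak R)$ is the set of finite paths in this diagram, vertices being identified with paths of length $0$. For an arrow $\gamma$ with winner $\alpha$ and loser $\beta$ let $B_\gamma e_\alpha=e_\alpha+e_\beta$ and $B_\gamma e_\xi=e_\xi$ for $\xi\ne\alpha$, where $(e_\xi)_{\xi\in\mathcal A}$ is the canonical basis of $\mathbb R^{\mathcal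 A}$; extend to paths by $B_{\gamma_1\gamma_2}=B_{\gamma_2}B_{\gamma_1}$ and $B_\gamma=\mathrm{id}$ for paths of length $0$. Write $\mathbb R_+=(0,\infty)$. For $q\in\mathbb R_+^{\mathcal A}$ put $\Lambda_q=\{\lambda\in\mathbb R_+^{\mathcal A}:\langle\lambda,q\rangle<1\}$ and $\Lambda_{q,\gamma}=B_\gamma^{*}\Lambda_{B_\gamma q}$, where $B_\gamma^*$ is the transpose of $B_\gamma$. For $\Gamma\subset\Pi(\mathfrak R)$ and $\gamma\in\Pi(\mathfrak R)$ put $$P_q(\Gamma\mid\gamma)=\frac{\mathrm{Leb}\big(\bigcup_{\gamma'\in\Gamma_\gamma}\Lambda_{q,\gamma'}\big)}{\mathrm{Leb}(\Lambda_{q,\gamma})},$$ where $\Gamma_\gamma$ is the set of paths in $\Gamma$ that start by $\gamma$. For a non-empty $\mathcal A'\subset\mathcal A$ let $M_{\mathcal A'}(q)=\max_{\alpha\in\mathcal A'}q_\alpha$, and $M(q)=M_{\mathcal A}(q)$. **Theorem.** There exist $C>0$ and $\theta>0$, depending only on $\#\mathcal A$, such that for every Rauzy class $\mathfrak R$ on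 $\mathcal A$, every non-empty proper subset $\mathcal A'\subset\mathcal A$, all integers $0\le m\le M$, every $q\in\mathbb R_+^{\mathcal A}$ and every $\pi\in\mathfrak R$, $$P_q\Big(\big\{\gamma\in\Pi(\mathfrak R): M(B_\gamma q)>2^M M(q)\ \text{and}\ M_{\mathcal A'}(B_\gamma q)<2^{M-m}M(q)\big\}\,\Big|\,\pi\Big)\le C\,(m+1)^\theta\,2^{-m}.$$ -/

import Mathlib

universe u

/-- Combinatorial data on an alphabet `A` with `d = #A` letters: a pair of bijections from `A` to
the set of positions (here `{0, …, d - 1}`), displaying the letters in a top and a bottom row. -/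
structure CombData (A : Type u) [Fintype A] where
  top : A ≃ Fin (Fintype.card A)
  bot : A ≃ Fin (Fintype.card A)

/-- The two types of operations (and of arrows of a Rauzy diagram). -/
inductive RauzyType where
  | top
  | bot

/-- The rearrangement of the `d` positions that moves the last position to the position
immediately to the right of `k`; positions up to `k` are fixed, and the positions strictly between
`k` and the last one are shifted by one to the right. (If `k` is last, nothing moves.) -/
def moveLastAfter {d : ℕ} (k : Fin d) : Equiv.Perm (Fin d) where
  toFun p :=
    if (p : ℕ) ≤ k then p
    else if h : (p : ℕ) + 1 < d then ⟨p + 1, h⟩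
    else if h : (k : ℕ) + 1 < d then ⟨k + 1, h⟩ else p
  invFun p :=
    if (p : ℕ) ≤ k then p
    else if (p : ℕ) = k + 1 then ⟨d - 1, by have := k.isLt; omega⟩
    else ⟨p - 1, by have := p.isLt; omega⟩
  left_inv p := by
    have hp := p.isLt
    have hk := k.isLt
    apply Fin.ext
    by_cases h1 : (p : ℕ) ≤ k
    · simp [h1]
    · by_cases h2 : (p : ℕ) + 1 < d
      · have h3 : ¬ (p : ℕ) + 1 ≤ k := by omega
        have h4 : (p : ℕ) ≠ k := by omega
        simp [h1, h2, h3, h4]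
      · have h3 : (k : ℕ) + 1 < d := by omega
        simp [h1, h2, h3]
        omega
  right_inv p := by
    have hp := p.isLt
    have hk := k.isLt
    apply Fin.ext
    by_cases h1 : (p : ℕ) ≤ k
    · simp [h1]
    · by_cases h2 : (p : ℕ) = k + 1
      · have h3 : ¬ d - 1 ≤ (k : ℕ) := by omega
        have h4 : ¬ d - 1 + 1 < d := by omega
        have h5 : (k : ℕ) + 1 < d := by omega
        simp [h2, h3, h4, h5]
      · have h3 : ¬ (p : ℕ) - 1 ≤ k := by omega
        have h4 : (p : ℕ) - 1 + 1 = p := by omega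
        simp [h1, h2, h3, h4]

namespace CombData

variable {A : Type u} [Fintype A]

/-- Irreducibility: for `1 ≤ k < d`, the set of the first `k` letters of the top row differs from
the set of the first `k` letters of the bottom row. -/
def IsIrreducible (π : CombData A) : Prop :=
  ∀ k : ℕ, 1 ≤ k → k < Fintype.card A →
    {ξ : A | (π.top ξ : ℕ) < k} ≠ {ξ : A | (π.bot ξ : ℕ) < k}

variable [Nontrivial A]

/-- The last letter of the top row. -/
def lastTop (π : CombData A) : A :=
  π.top.symm ⟨Fintype.card A - 1, Nat.sub_lt Fintype.card_pos one_pos⟩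

/-- The last letter of the bottom row. -/
def lastBot (π : CombData A) : A :=
  π.bot.symm ⟨Fintype.card A - 1, Nat.sub_lt Fintype.card_pos one_pos⟩

/-- The top (resp. bottom) operation: the last letter of the bottom (resp. top) row is moved, in
that row, to the position immediately to the right of the last letter of the other row. -/
def move (π : CombData A) : RauzyType → CombData A
  | .top => ⟨π.top, π.bot.trans (moveLastAfter (π.bot π.lastTop))⟩
  | .bot => ⟨π.top.trans (moveLastAfter (π.top π.lastBot)), π.bot⟩

/-- The winner of the arrow of type `ε` starting at `π`. -/
def winner (π : CombData A) : RauzyType → A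
  | .top => π.lastTop
  | .bot => π.lastBot

/-- The loser of the arrow of type `ε` starting at `π`. -/
def loser (π : CombData A) : RauzyType → A
  | .top => π.lastBot
  | .bot => π.lastTop

end CombData

section

variable {A : Type u} [Fintype A] [Nontrivial A]

/-- A Rauzy class is a minimal non-empty set of irreducible combinatorial data that is invariant
under the top and bottom operations. -/
def IsRauzyClass (R : Set (CombData A)) : Prop :=
  Minimal (fun S : Set (CombData A) =>
    S.Nonempty ∧ (∀ π ∈ S, π.IsIrreducible) ∧ ∀ π ∈ S, ∀ ε, π.move ε ∈ S) R

/-- A path in the Rauzy diagram with vertex set `R`. As every vertex is the start of exactly one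
arrow of each type, a path is given by its start and the list of the types of its arrows. -/
structure RauzyPath (R : Set (CombData A)) where
  start : CombData A
  start_mem : start ∈ R
  types : List RauzyType

variable [DecidableEq A]

/-- The matrix of the arrow with winner `α` and loser `β`: it sends `e_α` to `e_α + e_β` and fixes
the other vectors of the canonical basis. -/
def arrowMatrix (π : CombData A) (ε : RauzyType) : Matrix A A ℝ :=
  Matrix.transvection (π.loser ε) (π.winner ε) 1

/-- The product of the matrices of the arrows met when following the arrow types in a list from
`π`, with the matrix of the first arrow on the right. -/
def pathMatrix : CombData A → List RauzyType → Matrix A A ℝ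
  | _, [] => 1
  | π, ε :: l => pathMatrix (π.move ε) l * arrowMatrix π ε

/-- The simplex `Λ_q = {λ ∈ ℝ_+^A : ⟨λ, q⟩ < 1}`. -/
def simplexBelow (q : A → ℝ) : Set (A → ℝ) :=
  {v | (∀ ξ, 0 < v ξ) ∧ ∑ ξ, v ξ * q ξ < 1}

/-- `M_S(q)`, the largest coordinate of `q` with index in the non-empty set `S` of letters. -/
def maxCoord (S : Finset A) (hS : S.Nonempty) (q : A → ℝ) : ℝ := S.sup' hS q

namespace RauzyPath

variable {R : Set (CombData A)}

/-- The trivial path at a vertex. -/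
def trivial (π : CombData A) (hπ : π ∈ R) : RauzyPath R := ⟨π, hπ, []⟩

/-- The matrix `B_γ` of a path. -/
def B (γ : RauzyPath R) : Matrix A A ℝ := pathMatrix γ.start γ.types

/-- `γ.StartsBy γs`: the path `γ` starts by the path `γs`, that is, `γs ≤ γ`. -/
def StartsBy (γ γs : RauzyPath R) : Prop := γ.start = γs.start ∧ γs.types <+: γ.types

/-- `Λ_{q,γ} = B_γ^* · Λ_{B_γ · q}`. -/
def cell (q : A → ℝ) (γ : RauzyPath R) : Set (A → ℝ) :=
  (fun v => γ.B.transpose.mulVec v) '' simplexBelow (γ.B.mulVec q)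

/-- `P_q(Γ | γ)`: the Lebesgue measure of the union of the sets `Λ_{q,γ'}`, over the paths
`γ' ∈ Γ` that start by `γ`, divided by the Lebesgue measure of `Λ_{q,γ}`. -/
noncomputable def condProb (q : A → ℝ) (Γ : Set (RauzyPath R)) (γ : RauzyPath R) : ℝ :=
  MeasureTheory.volume.real (⋃ γ' ∈ {γ' ∈ Γ | γ'.StartsBy γ}, cell q γ') /
    MeasureTheory.volume.real (cell q γ)

end RauzyPath

end

set_option linter.unusedSectionVars false

open Finset

/-! The matrices have determinant 1 and the volume of Λ_q is inversely proportional to the product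
of the coordinates of q. So the cells behave like a Markov chain on pairs (π, q): the arrow with
winner α and loser β has probability q_β / (q_α + q_β), and replaces q_β by q_α + q_β. The quotient
of volumes is bounded by a hitting probability of this chain. The coordinate of a letter which never
wins is a supermartingale, hence is multiplied by 2^m with probability at most 2^(-m).

Fix a letter a of A' and ℓ = 2^(M-m) M(q). Coordinates only increase, so q_a < ℓ along the whole
path, while the maximum of ℓ and the coordinates has to grow from ℓ to 2^m ℓ. The cost of this
growth is estimated for a set E of letters that may win, the others being forced to lose, by
induction on #E. Three estimates feed one another.

`WinnersDecay`: all winners lie in a proper subset G of E. They in fact lie in a smaller set E' on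
which the data is irreducible, and irreducibility on E gives a letter s in E outside G with a letter
of E' to its left in some row. Forcing s to lose changes the probability of a path by at least the
factor q_s(start) / q_s(end). Summing over the dyadic size of q_s(end) reduces to
`LosingLetterDecay` for E', which has fewer letters.

`SmallLetterDecay`: q_a stays below ℓ. As long as the set of letters with coordinate at least ℓ is
constant, either these letters never win, and the supermartingale bound applies, or only they win,
and `WinnersDecay` applies.

`LosingLetterDecay`: once all letters of E are large, s can no longer lose, so it only drifts to the
right in its row. While it is at rest, the winners are to its right, and `WinnersDecay` applies.
Before that, `SmallLetterDecay` applies.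

The number of phases is bounded in terms of #A. `exists_decay_of_phases` glues them: convolving two
such bounds only costs a power of m + 1. -/

instance RauzyType.instFintype : Fintype RauzyType where
  elems := ⟨{.top, .bot}, by simp⟩
  complete := by rintro (_ | _) <;> simp

/-! ### Hitting probabilities and supersolutions -/

section Hitting

variable {X : Type*} (step : X → RauzyType → X)

open scoped Classical in
/-- The probability of reaching `T` within `n` steps for the weighted transitions `K`. -/
noncomputable def hit (K : X → RauzyType → ℝ) (T : Set X) : ℕ → X → ℝ
  | 0, x => if x ∈ T then 1 else 0
  | n + 1, x => if x ∈ T then 1 else ∑ ε, K x ε * hit K T n (step x ε)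

/-- The weights are those of a sub-Markov kernel. -/
structure SubMarkov (K : X → RauzyType → ℝ) : Prop where
  nonneg : ∀ x ε, 0 ≤ K x ε
  sum_le : ∀ x, ∑ ε, K x ε ≤ 1

/-- `I` is stable under the transitions of non-zero weight. -/
def StableUnder (K : X → RauzyType → ℝ) (I : Set X) : Prop :=
  ∀ x ∈ I, ∀ ε, K x ε ≠ 0 → step x ε ∈ I

/-- The probability that `φ` is multiplied by `2 ^ m` is at most `C (m + 1) ^ θ 2 ^ (-m)`. -/
def Decay (K : X → RauzyType → ℝ) (φ : X → ℝ) (C : ℝ) (θ : ℕ) (I : Set X) : Prop :=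
  ∀ x ∈ I, ∀ m n : ℕ, hit step K {y | 2 ^ m * φ x ≤ φ y} n x ≤ C * (m + 1) ^ θ / 2 ^ m

open scoped Classical in
/-- The transitions of `K` which satisfy `Q`. -/
noncomputable def restrictKernel (K : X → RauzyType → ℝ) (Q : X → RauzyType → Prop) :
    X → RauzyType → ℝ :=
  fun x ε => if Q x ε then K x ε else 0

variable {step} {K K' : X → RauzyType → ℝ} {T T' I : Set X}

theorem hit_of_mem {x : X} (hx : x ∈ T) (n : ℕ) : hit step K T n x = 1 := by
  cases n <;> simp [hit, hx]

theorem hit_succ_of_notMem {x : X} (hx : x ∉ T) (n : ℕ) :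
    hit step K T (n + 1) x = ∑ ε, K x ε * hit step K T n (step x ε) := by
  simp [hit, hx]

theorem hit_nonneg (hK : ∀ x ε, 0 ≤ K x ε) (n : ℕ) (x : X) : 0 ≤ hit step K T n x := by
  induction n generalizing x with
  | zero => unfold hit; split_ifs <;> norm_num
  | succ n ih =>
    unfold hit
    split_ifs
    · norm_num
    · exact sum_nonneg fun ε _ => mul_nonneg (hK x ε) (ih _)

/-- Comparison with a family of supersolutions. -/
theorem hit_le_of_supersolution (hK : ∀ x ε, 0 ≤ K x ε) (hI : StableUnder step K I)
    (V : ℕ → X → ℝ) (h0 : ∀ n, ∀ x ∈ I, 0 ≤ V n x) (hT : ∀ n, ∀ x ∈ I, x ∈ T → 1 ≤ V n x)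
    (hV : ∀ n, ∀ x ∈ I, x ∉ T → ∑ ε, K x ε * V n (step x ε) ≤ V (n + 1) x) (n : ℕ) :
    ∀ x ∈ I, hit step K T n x ≤ V n x := by
  induction n with
  | zero =>
    intro x hx
    by_cases h : x ∈ T
    · rw [hit_of_mem h]; exact hT 0 x hx h
    · simpa [hit, h] using h0 0 x hx
  | succ n ih =>
    intro x hx
    by_cases h : x ∈ T
    · rw [hit_of_mem h]; exact hT _ x hx h
    · rw [hit_succ_of_notMem h]
      refine (sum_le_sum fun ε _ => ?_).trans (hV n x hx h)
      by_cases hz : K x ε = 0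
      · simp [hz]
      · exact mul_le_mul_of_nonneg_left (ih _ (hI x hx ε hz)) (hK x ε)

theorem hit_le_one (hK : SubMarkov K) (n : ℕ) (x : X) : hit step K T n x ≤ 1 := by
  refine hit_le_of_supersolution (I := Set.univ) hK.nonneg (fun _ _ _ _ => trivial)
    (fun _ _ => 1) (by simp) (by simp) (fun n x _ _ => ?_) n x trivial
  simpa using hK.sum_le x

/-- Outside `T` this is the recursion; on `T` the right side is 1. It lets hitting probabilities
serve as supersolutions everywhere. -/
theorem sum_mul_hit_le (hK : SubMarkov K) (n : ℕ) (x : X) :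
    ∑ ε, K x ε * hit step K T n (step x ε) ≤ hit step K T (n + 1) x := by
  by_cases h : x ∈ T
  · rw [hit_of_mem h]
    refine (sum_le_sum fun ε _ => ?_).trans (hK.sum_le x)
    exact mul_le_of_le_one_right (hK.nonneg x ε) (hit_le_one hK n _)
  · rw [hit_succ_of_notMem h]

/-- Domination along the reachable states. -/
theorem hit_mono (hK : SubMarkov K) (hK' : SubMarkov K') (hI : StableUnder step K I)
    (hKK : ∀ x ∈ I, ∀ ε, K x ε ≤ K' x ε) (hTT : ∀ x ∈ I, x ∈ T → x ∈ T') (n : ℕ) :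
    ∀ x ∈ I, hit step K T n x ≤ hit step K' T' n x := by
  refine hit_le_of_supersolution hK.nonneg hI (fun n x => hit step K' T' n x)
    (fun n x _ => hit_nonneg hK'.nonneg n x) (fun n x hx h => ?_) (fun n x hx h => ?_) n
  · rw [hit_of_mem (hTT x hx h)]
  · refine le_trans (sum_le_sum fun ε _ => ?_) (sum_mul_hit_le hK' n x)
    exact mul_le_mul_of_nonneg_right (hKK x hx ε) (hit_nonneg hK'.nonneg _ _)

theorem hit_union_le (hK : SubMarkov K) (n : ℕ) (x : X) :
    hit step K (T ∪ T') n x ≤ hit step K T n x + hit step K T' n x := by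
  refine hit_le_of_supersolution (I := Set.univ) hK.nonneg (fun _ _ _ _ => trivial)
    (fun n x => hit step K T n x + hit step K T' n x)
    (fun n x _ => add_nonneg (hit_nonneg hK.nonneg n x) (hit_nonneg hK.nonneg n x))
    (fun n x _ h => ?_) (fun n x _ h => ?_) n x trivial
  · rcases h with h | h
    · rw [hit_of_mem h]; linarith [hit_nonneg (step := step) (T := T') hK.nonneg n x]
    · rw [hit_of_mem h]; linarith [hit_nonneg (step := step) (T := T) hK.nonneg n x]
  · simp only [mul_add, sum_add_distrib]
    exact add_le_add (sum_mul_hit_le hK n x) (sum_mul_hit_le hK n x)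

theorem hit_eq_zero (hK : ∀ x ε, 0 ≤ K x ε) (hI : StableUnder step K I)
    (hT : ∀ x ∈ I, x ∉ T) (n : ℕ) (x : X) (hx : x ∈ I) : hit step K T n x = 0 :=
  le_antisymm (hit_le_of_supersolution hK hI (fun _ _ => 0) (by simp)
    (fun _ x hx h => absurd h (hT x hx)) (by simp) n x hx) (hit_nonneg hK n x)

theorem restrictKernel_le (hK : ∀ x ε, 0 ≤ K x ε) (Q : X → RauzyType → Prop) (x : X)
    (ε : RauzyType) : restrictKernel K Q x ε ≤ K x ε := by
  unfold restrictKernel; split_ifs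
  · exact le_rfl
  · exact hK x ε

theorem SubMarkov.restrict (hK : SubMarkov K) (Q : X → RauzyType → Prop) :
    SubMarkov (restrictKernel K Q) where
  nonneg x ε := by
    unfold restrictKernel; split_ifs
    · exact hK.nonneg x ε
    · exact le_rfl
  sum_le x := (sum_le_sum fun ε _ => restrictKernel_le hK.nonneg Q x ε).trans (hK.sum_le x)

theorem restrictKernel_ne_zero {Q : X → RauzyType → Prop} {x : X} {ε : RauzyType} :
    restrictKernel K Q x ε ≠ 0 ↔ Q x ε ∧ K x ε ≠ 0 := by
  unfold restrictKernel; split_ifs with h <;> simp [h]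

theorem restrictKernel_of {Q : X → RauzyType → Prop} {x : X} {ε : RauzyType} (h : Q x ε) :
    restrictKernel K Q x ε = K x ε := if_pos h

/-- Transitions that leave a set containing the target forever may be discarded. -/
theorem hit_le_hit_restrict (hK : SubMarkov K) {J : Set X} (hJ : StableUnder step K Jᶜ)
    (hT : T ⊆ J) (n : ℕ) (x : X) :
    hit step K T n x ≤ hit step (restrictKernel K fun x ε => step x ε ∈ J) T n x := by
  induction n generalizing x with
  | zero => exact le_rfl
  | succ n ih =>
    by_cases h : x ∈ T
    · rw [hit_of_mem h, hit_of_mem h]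
    · rw [hit_succ_of_notMem h, hit_succ_of_notMem h]
      refine sum_le_sum fun ε _ => ?_
      by_cases hs : step x ε ∈ J
      · rw [restrictKernel_of (Q := fun x ε => step x ε ∈ J) hs]
        exact mul_le_mul_of_nonneg_left (ih _) (hK.nonneg x ε)
      · rw [hit_eq_zero hK.nonneg hJ (fun y hy h => hy (hT h)) n _ hs, mul_zero]
        exact mul_nonneg ((hK.restrict _).nonneg _ _) (hit_nonneg (hK.restrict _).nonneg _ _)

/-- A letter-like quantity `f` with the supermartingale property reaches `c` with probability at
most `f / c`. -/
theorem hit_le_div (hK : ∀ x ε, 0 ≤ K x ε) (hI : StableUnder step K I) (f : X → ℝ)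
    (hf : ∀ x ∈ I, 0 ≤ f x) (hstep : ∀ x ∈ I, ∑ ε, K x ε * f (step x ε) ≤ f x) {c : ℝ} (hc : 0 < c)
    (hT : ∀ x ∈ I, x ∈ T → c ≤ f x) (n : ℕ) (x : X) (hx : x ∈ I) :
    hit step K T n x ≤ f x / c := by
  refine hit_le_of_supersolution hK hI (fun _ x => f x / c)
    (fun n x hx => div_nonneg (hf x hx) hc.le)
    (fun n x hx h => (one_le_div hc).2 (hT x hx h)) (fun n x hx _ => ?_) n x hx
  simp only [← mul_div_assoc, ← sum_div]
  exact div_le_div_of_nonneg_right (hstep x hx) hc.le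

/-- Within one phase, the comparison of kernels is only known on a set `J` that depends on the
starting state and that the process does not leave. -/
theorem Decay.mono_kernel {φ : X → ℝ} {C : ℝ} {θ : ℕ} (h : Decay step K' φ C θ I)
    (hK : SubMarkov K) (hK' : SubMarkov K') {x : X} (hx : x ∈ I) {J : Set X} (hxJ : x ∈ J)
    (hJ : StableUnder step K J) (hKK : ∀ y ∈ J, ∀ ε, K y ε ≤ K' y ε) (m n : ℕ) :
    hit step K {y | 2 ^ m * φ x ≤ φ y} n x ≤ C * (m + 1) ^ θ / 2 ^ m :=
  (hit_mono hK hK' hJ hKK (fun _ _ h => h) n x hxJ).trans (h x hx m n)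

end Hitting

/-! ### Gluing finitely many phases -/

/-- If a bounded index `p` is non-decreasing along the transitions, and the transitions which keep
`p` have the decay property, then so do all transitions. -/
theorem exists_decay_of_phases (C : ℝ) (hC : 1 ≤ C) (θ N : ℕ) :
    ∃ C' : ℝ, 1 ≤ C' ∧ ∃ θ' : ℕ, ∀ {X : Type u} (step : X → RauzyType → X)
      (K : X → RauzyType → ℝ) (I : Set X) (φ : X → ℝ) (p : X → ℕ), SubMarkov K →
      StableUnder step K I → (∀ x ∈ I, 0 < φ x) →
      (∀ x ∈ I, ∀ ε, K x ε ≠ 0 → φ x ≤ φ (step x ε) ∧ φ (step x ε) ≤ 2 * φ x) →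
      (∀ x ∈ I, ∀ ε, K x ε ≠ 0 → p x ≤ p (step x ε)) → (∀ x ∈ I, p x ≤ N) →
      Decay step (restrictKernel K fun x ε => p (step x ε) = p x) φ C θ I →
      Decay step K φ C' θ' I := by
  -- Induction from the last phase backwards: `j` bounds the number of values of `p` still
  -- available, and `j = N + 1` covers everything.
  suffices H : ∀ j : ℕ, ∃ C' : ℝ, 1 ≤ C' ∧ ∃ θ' : ℕ, ∀ {X : Type u} (step : X → RauzyType → X)
      (K : X → RauzyType → ℝ) (I : Set X) (φ : X → ℝ) (p : X → ℕ), SubMarkov K →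
      StableUnder step K I → (∀ x ∈ I, 0 < φ x) →
      (∀ x ∈ I, ∀ ε, K x ε ≠ 0 → φ x ≤ φ (step x ε) ∧ φ (step x ε) ≤ 2 * φ x) →
      (∀ x ∈ I, ∀ ε, K x ε ≠ 0 → p x ≤ p (step x ε)) → (∀ x ∈ I, p x ≤ N) →
      Decay step (restrictKernel K fun x ε => p (step x ε) = p x) φ C θ I →
      Decay step K φ C' θ' {x ∈ I | N < p x + j} by
    obtain ⟨C', h1, θ', h⟩ := H (N + 1)
    refine ⟨C', h1, θ', fun step K I φ p a b c e f g k x hx m n => ?_⟩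
    exact h step K I φ p a b c e f g k x ⟨hx, by omega⟩ m n
  intro j
  induction j with
  | zero =>
    refine ⟨1, le_rfl, 0, fun step K I φ p _ _ _ _ _ hN _ x hx => ?_⟩
    have := hN x hx.1
    have := hx.2
    omega
  | succ j ih =>
    obtain ⟨C₁, hC₁, θ₁, ih⟩ := ih
    -- The 4 is the price of two factors 2, one for rounding to a power of 2 and one for the exit
    -- step. The extra exponent counts the `m` scales at which the phase may end.
    refine ⟨C + 4 * C * C₁, by nlinarith, θ + θ₁ + 1, ?_⟩
    intro X step K I φ p hK hI hφ hφ2 hp hN hD x₀ hx₀ m n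
    have ih' := ih step K I φ p hK hI hφ hφ2 hp hN hD
    set K₁ := restrictKernel K fun x ε => p (step x ε) = p x with hK₁
    have sK₁ : SubMarkov K₁ := hK.restrict _
    have hφ0 : 0 < φ x₀ := hφ x₀ hx₀.1
    -- Bound for reaching the target after leaving the phase from a value between `2 ^ i` and `2 ^
    -- (i + 1)` times `φ x₀`. The exit step may double it, so a factor `2 ^ (m - (i + 2))` remains;
    -- truncation to 0 gives a bound at least 1.
    let c : ℕ → ℝ := fun i => C₁ * ((m : ℝ) + 1) ^ θ₁ / 2 ^ (m - (i + 2))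
    have hc : ∀ i, 0 ≤ c i := fun i => by positivity
    let h : ℕ → ℕ → X → ℝ := fun i n y => hit step K₁ {y | 2 ^ i * φ x₀ ≤ φ y} n y
    have hh : ∀ i n y, 0 ≤ h i n y := fun i n y => hit_nonneg sK₁.nonneg n y
    let S : ℕ → X → ℝ := fun n y => h m n y + ∑ i ∈ range m, c i * h i n y
    have hS : ∀ n y, 0 ≤ S n y := fun n y =>
      add_nonneg (hh _ _ _) (sum_nonneg fun i _ => mul_nonneg (hc i) (hh _ _ _))
    let T : Set X := {y | 2 ^ m * φ x₀ ≤ φ y}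
    -- In the initial phase, either the target is reached there or the phase ends at some scale `i`;
    -- afterwards the exact probability is kept.
    let V : ℕ → X → ℝ := fun n y => if p y = p x₀ then S n y else hit step K T n y
    have key : hit step K T n x₀ ≤ V n x₀ := by
      refine hit_le_of_supersolution (I := {y ∈ I | p x₀ ≤ p y ∧ φ x₀ ≤ φ y}) hK.nonneg ?_ V ?_ ?_
        ?_ n x₀ ⟨hx₀.1, le_rfl, le_rfl⟩
      · rintro y ⟨hy, hy1, hy2⟩ ε hz
        exact ⟨hI y hy ε hz, hy1.trans (hp y hy ε hz), hy2.trans (hφ2 y hy ε hz).1⟩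
      · intro n y _
        dsimp only [V]
        split_ifs
        · exact hS n y
        · exact hit_nonneg hK.nonneg n y
      · intro n y _ hyT
        dsimp only [V]
        split_ifs
        · have : h m n y = 1 := hit_of_mem hyT n
          have h2 : 0 ≤ ∑ i ∈ range m, c i * h i n y :=
            sum_nonneg fun i _ => mul_nonneg (hc i) (hh _ _ _)
          dsimp only [S]; linarith
        · rw [hit_of_mem hyT]
      · rintro n y ⟨hy, hy1, hy2⟩ hyT
        by_cases hpy : p y = p x₀
        · have hyT' : φ y < 2 ^ m * φ x₀ := not_le.1 hyT
          obtain ⟨i, hi1, hi2⟩ : ∃ i : ℕ, 2 ^ i ≤ φ y / φ x₀ ∧ φ y / φ x₀ < 2 ^ (i + 1) :=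
            exists_nat_pow_near ((one_le_div hφ0).2 hy2) one_lt_two
          rw [le_div_iff₀ hφ0] at hi1
          rw [div_lt_iff₀ hφ0] at hi2
          have him : i < m := by
            by_contra hcon
            have : (2 : ℝ) ^ m ≤ 2 ^ i := pow_le_pow_right₀ (by norm_num) (not_lt.1 hcon)
            nlinarith
          have hV : V (n + 1) y = S (n + 1) y := if_pos hpy
          rw [hV]
          have hK₁le : ∀ ε, 0 ≤ K y ε - K₁ y ε := fun ε =>
            sub_nonneg.2 (restrictKernel_le hK.nonneg _ _ _)
          have h1 : ∀ ε, K y ε * V n (step y ε) ≤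
              K₁ y ε * S n (step y ε) + c i * (K y ε - K₁ y ε) := by
            intro ε
            by_cases hz : K y ε = 0
            · have : K₁ y ε = 0 := by simp [hK₁, restrictKernel, hz]
              simp [hz, this]
            by_cases hq : p (step y ε) = p y
            · have e1 : K₁ y ε = K y ε := by simp [hK₁, restrictKernel, hq]
              have e2 : V n (step y ε) = S n (step y ε) := if_pos (hq.trans hpy)
              rw [e1, e2]; simp
            · have e1 : K₁ y ε = 0 := by simp [hK₁, restrictKernel, hq]
              have hlt : p x₀ < p (step y ε) := by
                have := hp y hy ε hz; omega
              have e2 : V n (step y ε) = hit step K T n (step y ε) := if_neg hlt.ne'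
              have hyI := hI y hy ε hz
              have hφy := hφ _ hyI
              have hb : hit step K T n (step y ε) ≤ c i := by
                have h3 := ih' (step y ε) ⟨hyI, by have := hx₀.2; omega⟩ (m - (i + 2)) n
                have h4 : C₁ * (((m - (i + 2) : ℕ) : ℝ) + 1) ^ θ₁ / 2 ^ (m - (i + 2)) ≤ c i := by
                  have : ((m - (i + 2) : ℕ) : ℝ) ≤ m := by exact_mod_cast Nat.sub_le _ _
                  dsimp only [c]
                  gcongr
                by_cases h5 : i + 2 ≤ m
                · refine le_trans ?_ (h3.trans h4)
                  refine hit_mono (I := Set.univ) hK hK (fun _ _ _ _ => trivial)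
                    (fun _ _ _ => le_rfl) (fun z _ hzT => ?_) n _ trivial
                  have hzT' : 2 ^ m * φ x₀ ≤ φ z := hzT
                  change 2 ^ (m - (i + 2)) * φ (step y ε) ≤ φ z
                  refine le_trans ?_ hzT'
                  have e : (2 : ℝ) ^ m = 2 ^ (m - (i + 2)) * 2 ^ (i + 2) := by
                    rw [← pow_add]; congr 1; omega
                  rw [e, mul_assoc]
                  refine mul_le_mul_of_nonneg_left ?_ (by positivity)
                  have := (hφ2 y hy ε hz).2
                  have e3 : (2 : ℝ) ^ (i + 2) = 2 * 2 ^ (i + 1) := by ring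
                  rw [e3]; nlinarith
                · refine (hit_le_one hK _ _).trans (le_trans ?_ h4)
                  have : m - (i + 2) = 0 := by omega
                  simp [this, hC₁]
              rw [e1, e2, zero_mul, zero_add, sub_zero, mul_comm]
              exact mul_le_mul_of_nonneg_right hb (hK.nonneg y ε)
          refine (sum_le_sum fun ε _ => h1 ε).trans ?_
          have hhm := sum_mul_hit_le (step := step) (T := {y | 2 ^ m * φ x₀ ≤ φ y}) sK₁ n y
          -- At the current scale `i` the hitting probability is already 1, whereas its mean after
          -- the step is at most the total weight of `K₁`. This slack pays for the transitions that
          -- leave the phase.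
          have hhi : ∀ k ∈ range m, (∑ ε, K₁ y ε * (c k * h k n (step y ε))) +
              (if k = i then c i * ∑ ε, (K y ε - K₁ y ε) else 0) ≤ c k * h k (n + 1) y := by
            intro k _
            have e : ∑ ε, K₁ y ε * (c k * h k n (step y ε)) =
                c k * ∑ ε, K₁ y ε * h k n (step y ε) := by
              rw [mul_sum]; exact sum_congr rfl fun ε _ => by ring
            rw [e]
            split_ifs with hk
            · subst hk
              rw [← mul_add]
              refine mul_le_mul_of_nonneg_left ?_ (hc k)
              have e1 : h k (n + 1) y = 1 := hit_of_mem (T := {y | 2 ^ k * φ x₀ ≤ φ y}) hi1 _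
              rw [e1, ← sum_add_distrib]
              refine (sum_le_sum fun ε _ => ?_).trans (hK.sum_le y)
              have : K₁ y ε * h k n (step y ε) ≤ K₁ y ε :=
                mul_le_of_le_one_right (sK₁.nonneg _ _) (hit_le_one sK₁ _ _)
              linarith
            · rw [add_zero]
              exact mul_le_mul_of_nonneg_left (sum_mul_hit_le sK₁ n y) (hc k)
          have hsum := sum_le_sum hhi
          rw [sum_add_distrib, sum_ite_eq' (range m) i, if_pos (mem_range.2 him)] at hsum
          dsimp only [S]
          have e5 : ∑ ε, (K₁ y ε * (h m n (step y ε) + ∑ k ∈ range m, c k * h k n (step y ε)) +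
              c i * (K y ε - K₁ y ε)) = ∑ ε, K₁ y ε * h m n (step y ε) +
              ∑ k ∈ range m, ∑ ε, K₁ y ε * (c k * h k n (step y ε)) +
              c i * ∑ ε, (K y ε - K₁ y ε) := by
            rw [sum_comm (s := range m)]
            simp only [mul_add, mul_sum, sum_add_distrib]
          rw [e5]
          have : h m (n + 1) y = hit step K₁ {y | 2 ^ m * φ x₀ ≤ φ y} (n + 1) y := rfl
          have e6 : ∑ ε, K₁ y ε * h m n (step y ε) ≤ h m (n + 1) y := hhm
          linarith
        · have hV : V (n + 1) y = hit step K T (n + 1) y := if_neg hpy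
          rw [hV, hit_succ_of_notMem hyT]
          refine le_of_eq (sum_congr rfl fun ε _ => ?_)
          by_cases hz : K y ε = 0
          · simp [hz]
          · have := hp y hy ε hz
            have : V n (step y ε) = hit step K T n (step y ε) := if_neg (by omega)
            rw [this]
    refine key.trans ?_
    have hV : V n x₀ = S n x₀ := if_pos rfl
    rw [hV]
    have hm1 : (1 : ℝ) ≤ m + 1 := by linarith [(Nat.cast_nonneg m : (0 : ℝ) ≤ m)]
    have b1 : h m n x₀ ≤ C * ((m : ℝ) + 1) ^ (θ + θ₁ + 1) / 2 ^ m := by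
      refine (hD x₀ hx₀.1 m n).trans ?_
      gcongr ?_ * ?_ / _
      exact pow_le_pow_right₀ hm1 (by omega)
    have b2 : ∀ i ∈ range m, c i * h i n x₀ ≤
        4 * C * C₁ * ((m : ℝ) + 1) ^ (θ + θ₁) / 2 ^ m := by
      intro i hi
      have him : i ≤ m := (mem_range.1 hi).le
      have b3 : h i n x₀ ≤ C * ((m : ℝ) + 1) ^ θ / 2 ^ i := by
        refine (hD x₀ hx₀.1 i n).trans ?_
        have : (i : ℝ) ≤ m := by exact_mod_cast him
        gcongr
      have b4 : c i ≤ C₁ * ((m : ℝ) + 1) ^ θ₁ * (4 * 2 ^ i / 2 ^ m) := by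
        dsimp only [c]
        rw [div_eq_mul_inv]
        refine mul_le_mul_of_nonneg_left ?_ (by positivity)
        rw [inv_eq_one_div, div_le_div_iff₀ (by positivity) (by positivity), one_mul]
        have e : (4 : ℝ) * 2 ^ i * 2 ^ (m - (i + 2)) = 2 ^ (i + 2 + (m - (i + 2))) := by
          rw [pow_add, pow_add]; ring
        rw [e]
        exact pow_le_pow_right₀ (by norm_num) (by omega)
      refine (mul_le_mul b4 b3 (hh _ _ _) (by positivity)).trans (le_of_eq ?_)
      field_simp
      ring
    have b5 := sum_le_sum b2
    rw [sum_const, card_range, nsmul_eq_mul] at b5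
    dsimp only [S]
    refine (add_le_add b1 b5).trans ?_
    have : (m : ℝ) * (4 * C * C₁ * ((m : ℝ) + 1) ^ (θ + θ₁) / 2 ^ m) ≤
        4 * C * C₁ * ((m : ℝ) + 1) ^ (θ + θ₁ + 1) / 2 ^ m := by
      rw [pow_succ _ (θ + θ₁), ← mul_div_assoc]
      gcongr ?_ / _
      have : 0 ≤ 4 * C * C₁ * ((m : ℝ) + 1) ^ (θ + θ₁) := by positivity
      nlinarith
    refine (add_le_add_right this _).trans (le_of_eq ?_)
    ring

/-- The other type of operation. -/
def RauzyType.opp : RauzyType → RauzyType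
  | .top => .bot
  | .bot => .top

theorem RauzyType.eq_or_eq_opp (ε δ : RauzyType) : δ = ε ∨ δ = ε.opp := by
  cases ε <;> cases δ <;> simp [RauzyType.opp]

theorem RauzyType.sum_eq (f : RauzyType → ℝ) (ε : RauzyType) : ∑ δ, f δ = f ε + f ε.opp := by
  have h : ∑ δ, f δ = f .top + f .bot := by
    have : (univ : Finset RauzyType).val = {.top, .bot} := rfl
    simp [Finset.sum, this]
  cases ε
  · exact h
  · rw [h, add_comm]; rfl

/-! ### Positions, final subsets and irreducibility -/

section Positions

variable {A : Type u} [Fintype A]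

namespace CombData

/-- The position of a letter in the top or bottom row. -/
def pos (π : CombData A) : RauzyType → A → ℕ
  | .top, ξ => π.top ξ
  | .bot, ξ => π.bot ξ

theorem pos_lt (π : CombData A) (ε : RauzyType) (ξ : A) : π.pos ε ξ < Fintype.card A := by
  cases ε
  · exact (π.top ξ).isLt
  · exact (π.bot ξ).isLt

theorem pos_injective (π : CombData A) (ε : RauzyType) : Function.Injective (π.pos ε) := by
  intro ξ η h
  cases ε
  · exact π.top.injective (Fin.ext h)
  · exact π.bot.injective (Fin.ext h)

variable [Nontrivial A]

theorem pos_winner (π : CombData A) (ε : RauzyType) :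
    π.pos ε (π.winner ε) + 1 = Fintype.card A := by
  have := Fintype.card_pos (α := A)
  cases ε <;> simp [pos, winner, lastTop, lastBot] <;> omega

theorem loser_eq (π : CombData A) (ε : RauzyType) : π.loser ε = π.winner ε.opp := by
  cases ε <;> rfl

theorem pos_opp_loser (π : CombData A) (ε : RauzyType) :
    π.pos ε.opp (π.loser ε) + 1 = Fintype.card A := by
  rw [loser_eq]; exact pos_winner π _

theorem pos_le_winner (π : CombData A) (ε : RauzyType) (ξ : A) :
    π.pos ε ξ ≤ π.pos ε (π.winner ε) := by
  have := π.pos_winner ε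
  have := π.pos_lt ε ξ
  omega

theorem pos_move (π : CombData A) (ε : RauzyType) (ξ : A) : (π.move ε).pos ε ξ = π.pos ε ξ := by
  cases ε <;> rfl

theorem pos_move_opp (π : CombData A) (ε : RauzyType) (ξ : A) :
    (π.move ε).pos ε.opp ξ =
      if π.pos ε.opp ξ ≤ π.pos ε.opp (π.winner ε) then π.pos ε.opp ξ
      else if π.pos ε.opp ξ + 1 < Fintype.card A then π.pos ε.opp ξ + 1
      else if π.pos ε.opp (π.winner ε) + 1 < Fintype.card A then π.pos ε.opp (π.winner ε) + 1
      else π.pos ε.opp ξ := by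
  cases ε <;> simp only [pos, move, RauzyType.opp, Equiv.trans_apply, moveLastAfter, winner,
    Equiv.coe_fn_mk] <;> split_ifs <;> simp [*]

theorem pos_opp_winner_lt {π : CombData A} {ε : RauzyType} (h : π.winner ε ≠ π.loser ε) :
    π.pos ε.opp (π.winner ε) + 1 < Fintype.card A := by
  have h1 := π.pos_opp_loser ε
  have h2 := π.pos_lt ε.opp (π.winner ε)
  have h3 : π.pos ε.opp (π.winner ε) ≠ π.pos ε.opp (π.loser ε) :=
    fun e => h (π.pos_injective _ e)
  omega

theorem pos_move_opp_loser {π : CombData A} {ε : RauzyType} (h : π.winner ε ≠ π.loser ε) :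
    (π.move ε).pos ε.opp (π.loser ε) = π.pos ε.opp (π.winner ε) + 1 := by
  have h1 := π.pos_opp_loser ε
  have h2 := pos_opp_winner_lt h
  rw [pos_move_opp]
  split_ifs <;> omega

theorem pos_move_opp_of_le {π : CombData A} {ε : RauzyType} {ξ : A}
    (hξ : π.pos ε.opp ξ ≤ π.pos ε.opp (π.winner ε)) :
    (π.move ε).pos ε.opp ξ = π.pos ε.opp ξ := by
  rw [pos_move_opp, if_pos hξ]

theorem pos_add_one_lt_of_ne_loser {π : CombData A} {ε : RauzyType} {ξ : A} (h : ξ ≠ π.loser ε) :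
    π.pos ε.opp ξ + 1 < Fintype.card A := by
  have h1 := π.pos_opp_loser ε
  have h2 := π.pos_lt ε.opp ξ
  have h3 : π.pos ε.opp ξ ≠ π.pos ε.opp (π.loser ε) := fun e => h (π.pos_injective _ e)
  omega

theorem pos_move_opp_of_lt {π : CombData A} {ε : RauzyType} {ξ : A} (h : ξ ≠ π.loser ε)
    (hξ : π.pos ε.opp (π.winner ε) < π.pos ε.opp ξ) :
    (π.move ε).pos ε.opp ξ = π.pos ε.opp ξ + 1 := by
  rw [pos_move_opp, if_neg (not_le.2 hξ), if_pos (pos_add_one_lt_of_ne_loser h)]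

theorem pos_move_opp_lt_iff {π : CombData A} {ε : RauzyType} {ξ η : A}
    (hξ : ξ ≠ π.loser ε) (hη : η ≠ π.loser ε) :
    (π.move ε).pos ε.opp ξ < (π.move ε).pos ε.opp η ↔ π.pos ε.opp ξ < π.pos ε.opp η := by
  have h1 := pos_add_one_lt_of_ne_loser hξ
  have h2 := pos_add_one_lt_of_ne_loser hη
  rw [pos_move_opp, pos_move_opp]
  split_ifs <;> omega

/-- In both rows, the letters of `F` are to the right of the other letters of `G`. -/
def IsFinal (G F : Finset A) (π : CombData A) : Prop :=
  ∀ x ∈ G, x ∉ F → ∀ y ∈ F, ∀ ε, π.pos ε x < π.pos ε y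

/-- Irreducibility of the data obtained by erasing the letters outside `E`. -/
def IrreducibleOn (E : Finset A) (π : CombData A) : Prop :=
  ∀ F ⊆ E, F.Nonempty → IsFinal E F π → F = E

theorem IsFinal.winner_mem {G F : Finset A} {π : CombData A} (h : IsFinal G F π)
    (hF : F.Nonempty) {ε : RauzyType} (hw : π.winner ε ∈ G) : π.winner ε ∈ F := by
  by_contra hc
  obtain ⟨y, hy⟩ := hF
  have := h _ hw hc y hy ε
  have := π.pos_le_winner ε y
  omega

/-- The winner is last in its row, so finality puts it in `F`. The loser is last in the other row,
so it cannot lie in `G` outside `F`, and it is reinserted just after the winner, still to the right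
of the rest of `G`. -/
theorem isFinal_move_iff {G F : Finset A} {π : CombData A} {ε : RauzyType}
    (hF : F.Nonempty) (hw : π.winner ε ∈ G) (hne : π.winner ε ≠ π.loser ε) :
    IsFinal G F (π.move ε) ↔ IsFinal G F π := by
  have hlw := pos_opp_winner_lt hne
  have hll := π.pos_opp_loser ε
  have hml := pos_move_opp_loser hne
  have hmw : (π.move ε).pos ε.opp (π.winner ε) = π.pos ε.opp (π.winner ε) :=
    pos_move_opp_of_le le_rfl
  -- Only the row `ε`, which the move does not change, is used, so this serves before and after the
  -- move.
  have hwF : ∀ h : (∀ x ∈ G, x ∉ F → ∀ y ∈ F, π.pos ε x < π.pos ε y), π.winner ε ∈ F := by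
    intro h
    by_contra hc
    obtain ⟨y, hy⟩ := hF
    have := h _ hw hc y hy
    have := π.pos_le_winner ε y
    omega
  constructor
  · intro h x hx hxF y hy δ
    have hwF' := hwF fun x hx hxF y hy => by
      have := h x hx hxF y hy ε
      rwa [pos_move, pos_move] at this
    rcases RauzyType.eq_or_eq_opp ε δ with rfl | rfl
    · have := h x hx hxF y hy δ
      rwa [pos_move, pos_move] at this
    · by_cases hxl : x = π.loser ε
      · have := h x hx hxF _ hwF' ε.opp
        rw [hxl, hml, hmw] at this
        omega
      · by_cases hyl : y = π.loser ε
        · have := pos_add_one_lt_of_ne_loser hxl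
          rw [hyl]; omega
        · exact (pos_move_opp_lt_iff hxl hyl).1 (h x hx hxF y hy _)
  · intro h x hx hxF y hy δ
    have hwF' := hwF fun x hx hxF y hy => h x hx hxF y hy ε
    rcases RauzyType.eq_or_eq_opp ε δ with rfl | rfl
    · rw [pos_move, pos_move]; exact h x hx hxF y hy δ
    · by_cases hxl : x = π.loser ε
      · have := h x hx hxF _ hwF' ε.opp
        rw [hxl] at this
        omega
      · by_cases hyl : y = π.loser ε
        · have := h x hx hxF _ hwF' ε.opp
          rw [hyl, hml, pos_move_opp_of_le this.le]
          omega
        · exact (pos_move_opp_lt_iff hxl hyl).2 (h x hx hxF y hy _)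

theorem IrreducibleOn.move {E : Finset A} {π : CombData A} {ε : RauzyType}
    (h : IrreducibleOn E π) (hw : π.winner ε ∈ E) (hne : π.winner ε ≠ π.loser ε) :
    IrreducibleOn E (π.move ε) :=
  fun F hFE hF hfin => h F hFE hF ((isFinal_move_iff hF hw hne).1 hfin)

/-- The letters of a non-empty set `G` have a final subset on which the data is irreducible. -/
theorem exists_isFinal_irreducibleOn (π : CombData A) {G : Finset A} (hG : G.Nonempty) :
    ∃ F ⊆ G, F.Nonempty ∧ IsFinal G F π ∧ IrreducibleOn F π := by
  classical
  obtain ⟨F, hF⟩ := exists_minimal_of_wellFoundedLT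
    (fun F : Finset A => F ⊆ G ∧ F.Nonempty ∧ IsFinal G F π)
    ⟨G, Subset.rfl, hG, fun x hx h => absurd hx h⟩
  obtain ⟨h1, h2, h3⟩ := hF.prop
  refine ⟨F, h1, h2, h3, fun F' hF' hne hfin => ?_⟩
  refine Subset.antisymm hF' (hF.le_of_le ⟨hF'.trans h1, hne, fun x hx hxF y hy ε => ?_⟩ hF')
  by_cases hxF' : x ∈ F
  · exact hfin x hxF' hxF y hy ε
  · exact h3 x hx hxF' y (hF' hy) ε

/-- The complement of a final subset fills the first positions of both rows, which irreducibility
forbids unless it is empty. -/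
theorem IsIrreducible.irreducibleOn {π : CombData A} (h : π.IsIrreducible) :
    IrreducibleOn univ π := by
  classical
  intro F _ hF hfin
  by_contra hne
  have key : ∀ ε, {ξ : A | π.pos ε ξ < #Fᶜ} = ↑Fᶜ := by
    intro ε
    have hcard : ∀ k ≤ Fintype.card A, #{ξ : A | π.pos ε ξ < k} = k := by
      intro k hk
      have : ({ξ : A | π.pos ε ξ < k} : Finset A).map ⟨π.pos ε, π.pos_injective ε⟩ = range k := by
        ext i
        simp only [mem_map, mem_filter, mem_univ, true_and, Function.Embedding.coeFn_mk, mem_range]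
        constructor
        · rintro ⟨ξ, h, rfl⟩; exact h
        · intro hi
          cases ε
          · exact ⟨π.top.symm ⟨i, hi.trans_le hk⟩, by simpa [pos] using hi, by simp [pos]⟩
          · exact ⟨π.bot.symm ⟨i, hi.trans_le hk⟩, by simpa [pos] using hi, by simp [pos]⟩
      rw [← card_map, this, card_range]
    -- A letter of `F` has all of `Fᶜ` to its left, so its position is at least `#Fᶜ`.
    have hsub : ({ξ : A | π.pos ε ξ < #Fᶜ} : Finset A) = Fᶜ := by
      refine eq_of_subset_of_card_le ?_ ?_
      · intro ξ hξ
        rw [mem_compl]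
        intro hξF
        have hlt : π.pos ε ξ < #Fᶜ := by simpa using hξ
        have : Fᶜ ⊆ ({η : A | π.pos ε η < π.pos ε ξ} : Finset A) := fun η hη => by
          simpa using hfin η (mem_univ _) (mem_compl.1 hη) ξ hξF ε
        have := card_le_card this
        rw [hcard _ (π.pos_lt ε ξ).le] at this
        omega
      · rw [hcard _ (card_le_univ _)]
    ext ξ
    simpa using Finset.ext_iff.1 hsub ξ
  have hc : 1 ≤ #Fᶜ := by
    rw [Nat.succ_le_iff, card_pos, nonempty_iff_ne_empty]
    intro h0
    exact hne (by simpa using h0)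
  have hc2 : #Fᶜ < Fintype.card A := by
    rw [card_compl]
    have := hF.card_pos
    have := card_le_univ F
    omega
  exact h _ hc hc2 ((key .top).trans (key .bot).symm)

/-- A letter that is last in both rows forms a final subset by itself. -/
theorem IsIrreducible.winner_ne_loser {π : CombData A} (h : π.IsIrreducible) (ε : RauzyType) :
    π.winner ε ≠ π.loser ε := by
  classical
  intro he
  have h1 := h.irreducibleOn {π.winner ε} (subset_univ _) (singleton_nonempty _) ?_
  · have := congrArg card h1
    rw [card_singleton, card_univ] at this
    have := Fintype.one_lt_card (α := A)
    omega
  · intro x _ hx y hy δ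
    rw [mem_singleton] at hx hy
    subst hy
    have h2 : π.winner δ = π.winner ε := by
      rcases RauzyType.eq_or_eq_opp ε δ with rfl | rfl
      · rfl
      · rw [← loser_eq, he]
    refine lt_of_le_of_ne ?_ fun e => hx (π.pos_injective _ e)
    rw [← h2]
    exact π.pos_le_winner δ x

end CombData

end Positions

/-- A set of data which is invariant under the operations, and whose members never have the same
last letter in both rows. -/
structure InvariantData (A : Type u) [Fintype A] [Nontrivial A] where
  carrier : Set (CombData A)
  move_mem : ∀ π ∈ carrier, ∀ ε, π.move ε ∈ carrier
  winner_ne : ∀ π ∈ carrier, ∀ ε, π.winner ε ≠ π.loser ε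

/-! ### The Markov chain on vertices and positive vectors -/

section Chain

variable {A : Type u} [Fintype A] [Nontrivial A]

/-- The states of the random process: a vertex and a positive vector. -/
structure ChainState (R : InvariantData A) where
  data : CombData A
  mem : data ∈ R.carrier
  q : A → ℝ
  q_pos : ∀ ξ, 0 < q ξ

variable [DecidableEq A] {R : InvariantData A}

namespace ChainState

/-- Following an arrow: the coordinate of the winner is added to that of the loser. -/
def next (x : ChainState R) (ε : RauzyType) : ChainState R where
  data := x.data.move ε
  mem := R.move_mem _ x.mem ε
  q := Function.update x.q (x.data.loser ε) (x.q (x.data.loser ε) + x.q (x.data.winner ε))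
  q_pos ξ := by
    by_cases h : ξ = x.data.loser ε
    · subst h; simpa using add_pos (x.q_pos _) (x.q_pos _)
    · simpa [h] using x.q_pos ξ

theorem next_q_loser (x : ChainState R) (ε : RauzyType) :
    (x.next ε).q (x.data.loser ε) = x.q (x.data.loser ε) + x.q (x.data.winner ε) := by
  simp [next]

theorem next_q_of_ne (x : ChainState R) {ε : RauzyType} {ξ : A} (h : ξ ≠ x.data.loser ε) :
    (x.next ε).q ξ = x.q ξ := by
  simp [next, h]

theorem le_next_q (x : ChainState R) (ε : RauzyType) (ξ : A) : x.q ξ ≤ (x.next ε).q ξ := by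
  by_cases h : ξ = x.data.loser ε
  · subst h; rw [next_q_loser]; linarith [x.q_pos (x.data.winner ε)]
  · rw [next_q_of_ne x h]

theorem winner_ne (x : ChainState R) (ε : RauzyType) : x.data.winner ε ≠ x.data.loser ε :=
  R.winner_ne _ x.mem ε

/-- The transition probabilities when the letters outside `E` always lose. -/
noncomputable def kernel (E : Finset A) (x : ChainState R) (ε : RauzyType) : ℝ :=
  if x.data.winner ε ∈ E then
    if x.data.loser ε ∈ E then
      x.q (x.data.loser ε) / (x.q (x.data.loser ε) + x.q (x.data.winner ε))
    else 1
  else 0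

theorem subMarkov_kernel (E : Finset A) : SubMarkov (kernel (R := R) E) where
  nonneg x ε := by
    have h1 := x.q_pos (x.data.loser ε)
    have h2 := x.q_pos (x.data.winner ε)
    unfold kernel; split_ifs <;> positivity
  sum_le x := by
    have h1 := x.q_pos (x.data.winner .top)
    have h2 := x.q_pos (x.data.winner .bot)
    rw [RauzyType.sum_eq _ .top]
    have e1 : x.data.loser .top = x.data.winner .bot := rfl
    have e2 : x.data.loser RauzyType.top.opp = x.data.winner .top := rfl
    have e3 : RauzyType.top.opp = .bot := rfl
    unfold kernel
    rw [e1, e2, e3]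
    by_cases ht : x.data.winner .top ∈ E <;> by_cases hb : x.data.winner .bot ∈ E <;>
      simp only [ht, hb, if_true, if_false]
    · rw [add_comm (x.q (x.data.winner .top)), ← add_div, div_self (by positivity)]
    all_goals norm_num

theorem winner_mem_of_kernel_ne_zero {E : Finset A} {x : ChainState R} {ε : RauzyType}
    (h : kernel E x ε ≠ 0) : x.data.winner ε ∈ E := by
  by_contra hc
  exact h (by simp [kernel, hc])

theorem kernel_le_one (E : Finset A) (x : ChainState R) (ε : RauzyType) : kernel E x ε ≤ 1 :=
  (single_le_sum (f := fun ε => kernel E x ε) (fun ε _ => (subMarkov_kernel E).nonneg x ε)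
    (mem_univ ε)).trans ((subMarkov_kernel E).sum_le x)

/-- The weight is the ratio of the old to the new coordinate of the loser, or zero. This is the
source of the supermartingales. -/
theorem kernel_mul_next_q_loser {E : Finset A} {x : ChainState R} {ε : RauzyType}
    (hl : x.data.loser ε ∈ E) :
    kernel E x ε * (x.next ε).q (x.data.loser ε) ≤ x.q (x.data.loser ε) := by
  have h1 := x.q_pos (x.data.loser ε)
  have h2 := x.q_pos (x.data.winner ε)
  rw [next_q_loser]
  unfold kernel
  simp only [hl, if_true]
  split_ifs
  · rw [div_mul_cancel₀ _ (by positivity)]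
  · rw [zero_mul]; exact h1.le

/-- The coordinate of a letter that does not win is a supermartingale. -/
theorem sum_mul_next_q_le {E : Finset A} {K : ChainState R → RauzyType → ℝ} (hK : SubMarkov K)
    {x : ChainState R} (hKE : ∀ ε, K x ε ≤ kernel E x ε) {z : A} (hz : z ∈ E)
    (hw : ∀ ε, K x ε ≠ 0 → x.data.winner ε ≠ z) :
    ∑ ε, K x ε * (x.next ε).q z ≤ x.q z := by
  by_cases h : ∃ ε, z = x.data.loser ε
  · obtain ⟨ε, rfl⟩ := h
    have h0 : K x ε.opp = 0 := by
      by_contra hc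
      exact hw _ hc (x.data.loser_eq ε).symm
    rw [RauzyType.sum_eq _ ε, h0, zero_mul, add_zero]
    exact (mul_le_mul_of_nonneg_right (hKE ε) ((x.next ε).q_pos _).le).trans
      (kernel_mul_next_q_loser hz)
  · push Not at h
    have : ∀ ε, K x ε * (x.next ε).q z = K x ε * x.q z := fun ε => by
      rw [next_q_of_ne x (h ε)]
    simp only [this, ← sum_mul]
    exact mul_le_of_le_one_left (x.q_pos z).le (hK.sum_le x)

/-- The largest of `ℓ` and the coordinates in `E`. -/
def level (E : Finset A) (ℓ : ℝ) (x : ChainState R) : ℝ := E.fold max ℓ x.q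

theorem le_level_iff {E : Finset A} {ℓ c : ℝ} {x : ChainState R} :
    c ≤ level E ℓ x ↔ c ≤ ℓ ∨ ∃ e ∈ E, c ≤ x.q e := le_fold_max c

theorem level_le_iff {E : Finset A} {ℓ c : ℝ} {x : ChainState R} :
    level E ℓ x ≤ c ↔ ℓ ≤ c ∧ ∀ e ∈ E, x.q e ≤ c := fold_max_le c

theorem base_le_level (E : Finset A) (ℓ : ℝ) (x : ChainState R) : ℓ ≤ level E ℓ x :=
  le_level_iff.2 (Or.inl le_rfl)

theorem q_le_level {E : Finset A} {e : A} (he : e ∈ E) (ℓ : ℝ) (x : ChainState R) :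
    x.q e ≤ level E ℓ x := le_level_iff.2 (Or.inr ⟨e, he, le_rfl⟩)

theorem level_le_level_next (E : Finset A) (ℓ : ℝ) (x : ChainState R) (ε : RauzyType) :
    level E ℓ x ≤ level E ℓ (x.next ε) :=
  level_le_iff.2 ⟨base_le_level _ _ _, fun _ he => (x.le_next_q ε _).trans (q_le_level he _ _)⟩

theorem level_next_le {E : Finset A} {ℓ : ℝ} (hℓ : 0 ≤ ℓ) {x : ChainState R} {ε : RauzyType}
    (hw : x.data.winner ε ∈ E) : level E ℓ (x.next ε) ≤ 2 * level E ℓ x := by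
  have h1 := base_le_level E ℓ x
  refine level_le_iff.2 ⟨by linarith, fun e he => ?_⟩
  have h2 := q_le_level he ℓ x
  have h3 := q_le_level hw ℓ x
  by_cases h : e = x.data.loser ε
  · subst h; rw [next_q_loser]; linarith
  · rw [next_q_of_ne x h]; linarith

end ChainState

end Chain

/-! ### Decay with a small letter, decay with a losing letter -/

section Estimates

open ChainState CombData

/-- Decay for the paths all of whose winners lie in a proper subset `G` of the set `E` of the
letters that can win. -/
def WinnersDecay (d n : ℕ) (C : ℝ) (θ : ℕ) : Prop :=
  ∀ (A : Type u) [Fintype A] [DecidableEq A] [Nontrivial A] (R : InvariantData A),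
    Fintype.card A = d → ∀ E : Finset A, #E ≤ n → ∀ G ⊂ E, ∀ ℓ : ℝ, 0 < ℓ →
      Decay next (restrictKernel (kernel (R := R) E) fun x ε => x.data.winner ε ∈ G)
        (level E ℓ) C θ {x | IrreducibleOn E x.data}

/-- Decay for the paths along which the coordinate of a letter `a` remains less than `ℓ`. -/
def SmallLetterDecay (d n : ℕ) (C : ℝ) (θ : ℕ) : Prop :=
  ∀ (A : Type u) [Fintype A] [DecidableEq A] [Nontrivial A] (R : InvariantData A),
    Fintype.card A = d → ∀ E : Finset A, #E ≤ n → ∀ a ∈ E, ∀ ℓ : ℝ, 0 < ℓ →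
      Decay next (restrictKernel (kernel (R := R) E) fun x ε => (next x ε).q a < ℓ)
        (level E ℓ) C θ {x | IrreducibleOn E x.data ∧ x.q a < ℓ}

/-- Decay for the paths along which a letter `s` which always loses, and has a letter of `E` to
its left in the row `δ`, has a coordinate less than `ℓ`. -/
def LosingLetterDecay (d n : ℕ) (C : ℝ) (θ : ℕ) : Prop :=
  ∀ (A : Type u) [Fintype A] [DecidableEq A] [Nontrivial A] (R : InvariantData A),
    Fintype.card A = d → ∀ E : Finset A, #E ≤ n → ∀ s ∉ E, ∀ (δ : RauzyType) (ℓ : ℝ), 0 < ℓ →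
      Decay next (restrictKernel (kernel (R := R) E) fun x ε => (next x ε).q s < ℓ)
        (level E ℓ) C θ
        {x | IrreducibleOn E x.data ∧ x.q s < ℓ ∧ ∃ e ∈ E, x.data.pos δ e < x.data.pos δ s}

variable {A : Type u} [Fintype A] [DecidableEq A] [Nontrivial A] {R : InvariantData A}

/-- The letters of `E` with coordinate at least `ℓ`. -/
noncomputable def largeLetters (E : Finset A) (ℓ : ℝ) (x : ChainState R) : Finset A :=
  {e ∈ E | ℓ ≤ x.q e}

theorem mem_largeLetters {E : Finset A} {ℓ : ℝ} {x : ChainState R} {e : A} :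
    e ∈ largeLetters E ℓ x ↔ e ∈ E ∧ ℓ ≤ x.q e := by
  simp [largeLetters]

theorem largeLetters_subset_next (E : Finset A) (ℓ : ℝ) (x : ChainState R) (ε : RauzyType) :
    largeLetters E ℓ x ⊆ largeLetters E ℓ (next x ε) := fun e he => by
  rw [mem_largeLetters] at he ⊢
  exact ⟨he.1, he.2.trans (x.le_next_q ε e)⟩

theorem card_largeLetters_le (E : Finset A) (ℓ : ℝ) (x : ChainState R) :
    #(largeLetters E ℓ x) ≤ #E := card_le_card fun _ he => (mem_largeLetters.1 he).1

theorem largeLetters_next_eq {E : Finset A} {ℓ : ℝ} {x : ChainState R} {ε : RauzyType}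
    (h : #(largeLetters E ℓ (next x ε)) ≤ #(largeLetters E ℓ x)) :
    largeLetters E ℓ (next x ε) = largeLetters E ℓ x :=
  (eq_of_subset_of_card_le (largeLetters_subset_next E ℓ x ε) h).symm

/-- One of the two last letters is in `E` and has coordinate less than `ℓ`. -/
def HasSmallEnd (E : Finset A) (ℓ : ℝ) (x : ChainState R) : Prop :=
  ∃ ε, x.data.winner ε ∈ E ∧ x.q (x.data.winner ε) < ℓ

/-- If the small last letter were beaten by a large one, it would become large and enlarge the set
of large letters. -/
theorem HasSmallEnd.winner_lt {E : Finset A} {ℓ : ℝ} {x : ChainState R} (h : HasSmallEnd E ℓ x)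
    {ε : RauzyType} (hL : largeLetters E ℓ (next x ε) = largeLetters E ℓ x) :
    x.q (x.data.winner ε) < ℓ := by
  obtain ⟨ε₀, h1, h2⟩ := h
  rcases RauzyType.eq_or_eq_opp ε ε₀ with rfl | rfl
  · exact h2
  · rw [← loser_eq] at h1 h2
    by_contra hc
    have : x.data.loser ε ∈ largeLetters E ℓ (next x ε) :=
      mem_largeLetters.2 ⟨h1, by rw [next_q_loser]; linarith [x.q_pos (x.data.loser ε)]⟩
    rw [hL, mem_largeLetters] at this
    linarith [this.2]

theorem winner_next (x : ChainState R) (ε : RauzyType) :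
    (next x ε).data.winner ε = x.data.winner ε := by
  refine (next x ε).data.pos_injective ε ?_
  have h1 := (next x ε).data.pos_winner ε
  have h2 := x.data.pos_winner ε
  rw [← pos_move] at h2
  exact Nat.succ_injective (h1.trans h2.symm)

theorem HasSmallEnd.next {E : Finset A} {ℓ : ℝ} {x : ChainState R} (h : HasSmallEnd E ℓ x)
    {ε : RauzyType} (hw : x.data.winner ε ∈ E)
    (hL : largeLetters E ℓ (next x ε) = largeLetters E ℓ x) : HasSmallEnd E ℓ (next x ε) := by
  refine ⟨ε, ?_, ?_⟩
  · rwa [winner_next]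
  · rw [winner_next, next_q_of_ne x (x.winner_ne ε)]
    exact h.winner_lt hL

/-- Letters that never win are unlikely to become large. -/
theorem hit_letters_le {E F : Finset A} (hF : F ⊆ E) {K : ChainState R → RauzyType → ℝ}
    (hK : SubMarkov K) {I T : Set (ChainState R)} (hI : StableUnder next K I)
    (hKE : ∀ y ∈ I, ∀ ε, K y ε ≤ kernel E y ε)
    (hw : ∀ y ∈ I, ∀ ε, K y ε ≠ 0 → y.data.winner ε ∉ F) {φ : ℝ} (hφ : 0 < φ) (m : ℕ)
    (hT : ∀ y ∈ I, y ∈ T → ∃ z ∈ F, 2 ^ m * φ ≤ y.q z) (n : ℕ) (x : ChainState R) (hx : x ∈ I)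
    (hxF : ∀ z ∈ F, x.q z ≤ φ) : hit next K T n x ≤ Fintype.card A / 2 ^ m := by
  have hpos : 0 < 2 ^ m * φ := by positivity
  refine (hit_le_div hK.nonneg hI (fun y => ∑ z ∈ F, y.q z)
    (fun y _ => sum_nonneg fun z _ => (y.q_pos z).le) (fun y hy => ?_) hpos
    (fun y hy hyT => ?_) n x hx).trans ?_
  · simp only [mul_sum]
    rw [sum_comm]
    exact sum_le_sum fun z hz => sum_mul_next_q_le hK (hKE y hy) (hF hz)
      fun ε hε he => hw y hy ε hε (he ▸ hz)
  · obtain ⟨z, hz, h⟩ := hT y hy hyT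
    exact h.trans (single_le_sum (f := y.q) (fun z _ => (y.q_pos z).le) hz)
  · rw [div_le_div_iff₀ hpos (by positivity)]
    have h1 : ∑ z ∈ F, x.q z ≤ #F * φ := by
      have := sum_le_card_nsmul F x.q φ hxF
      rwa [nsmul_eq_mul] at this
    have h2 : (#F : ℝ) ≤ Fintype.card A := by exact_mod_cast card_le_univ F
    have h3 : ∑ z ∈ F, x.q z ≤ Fintype.card A * φ := h1.trans (by gcongr)
    calc _ ≤ Fintype.card A * φ * 2 ^ m := by gcongr
      _ = _ := by ring

theorem const_mul_le_decay {C C' : ℝ} (hC : 0 ≤ C) (h : C ≤ C') {θ θ' : ℕ} (hθ : θ ≤ θ') (m : ℕ) :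
    C * ((m : ℝ) + 1) ^ θ / 2 ^ m ≤ C' * ((m : ℝ) + 1) ^ θ' / 2 ^ m := by
  have hm1 : (1 : ℝ) ≤ m + 1 := by linarith [(Nat.cast_nonneg m : (0 : ℝ) ≤ m)]
  have := pow_le_pow_right₀ hm1 hθ
  gcongr
  exact hC.trans h

/-- Fix the set of large letters. With a small last letter, every winner is small, so large letters
never win. Otherwise all winners are large, and the large letters form a proper subset of `E` since
`a` is small. -/
theorem exists_smallLetterDecay {d n : ℕ} {C : ℝ} {θ : ℕ} (hC : 1 ≤ C)
    (hW : WinnersDecay.{u} d n C θ) :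
    ∃ C' : ℝ, 1 ≤ C' ∧ ∃ θ' : ℕ, SmallLetterDecay.{u} d n C' θ' := by
  classical
  have hd : (0 : ℝ) ≤ d := Nat.cast_nonneg d
  obtain ⟨C', hC', θ', H⟩ := exists_decay_of_phases.{u} (C + d) (by linarith) θ (2 * d + 1)
  refine ⟨C', hC', θ', ?_⟩
  intro A _ _ _ R hA E hE a ha ℓ hℓ
  set K := restrictKernel (kernel (R := R) E) fun x ε => (next x ε).q a < ℓ with hKdef
  have hK : SubMarkov K := (subMarkov_kernel E).restrict _
  have hKE : ∀ x ε, K x ε ≤ kernel E x ε := restrictKernel_le (subMarkov_kernel E).nonneg _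
  have hwin : ∀ x ε, K x ε ≠ 0 → x.data.winner ε ∈ E := fun x ε h =>
    winner_mem_of_kernel_ne_zero (restrictKernel_ne_zero.1 h).2
  -- A small last letter persists until a new letter becomes large; the weight 2 makes the index
  -- increase even when it is then lost.
  let p : ChainState R → ℕ := fun x =>
    2 * #(largeLetters E ℓ x) + if HasSmallEnd E ℓ x then 1 else 0
  refine H next K _ (level E ℓ) p hK ?_ ?_ ?_ ?_ ?_ ?_
  · exact fun x hx ε h => ⟨hx.1.move (hwin x ε h) (x.winner_ne ε), (restrictKernel_ne_zero.1 h).1⟩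
  · exact fun x _ => hℓ.trans_le (base_le_level _ _ _)
  · exact fun x _ ε h => ⟨level_le_level_next _ _ _ _, level_next_le hℓ.le (hwin x ε h)⟩
  · intro x _ ε h
    have h1 := card_le_card (largeLetters_subset_next E ℓ x ε)
    dsimp only [p]
    by_cases h2 : #(largeLetters E ℓ (next x ε)) ≤ #(largeLetters E ℓ x)
    · have hL := largeLetters_next_eq h2
      by_cases hb : HasSmallEnd E ℓ x
      · rw [if_pos hb, if_pos (hb.next (hwin x ε h) hL)]; omega
      · rw [if_neg hb]; omega
    · split_ifs <;> omega
  · intro x _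
    have h1 := card_largeLetters_le E ℓ x
    have h2 := card_le_univ E
    dsimp only [p]
    split_ifs <;> omega
  · intro x hx m n
    set K₁ := restrictKernel K fun x ε => p (next x ε) = p x with hK₁def
    have hK₁ : SubMarkov K₁ := hK.restrict _
    have hK₁K : ∀ x ε, K₁ x ε ≤ K x ε := restrictKernel_le hK.nonneg _
    have hsame : ∀ y ε, K₁ y ε ≠ 0 → largeLetters E ℓ (next y ε) = largeLetters E ℓ y ∧
        (HasSmallEnd E ℓ (next y ε) ↔ HasSmallEnd E ℓ y) := by
      intro y ε h
      have h1 := (restrictKernel_ne_zero.1 h).1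
      have h2 := card_le_card (largeLetters_subset_next E ℓ y ε)
      dsimp only [p] at h1
      have h3 : #(largeLetters E ℓ (next y ε)) ≤ #(largeLetters E ℓ y) := by
        split_ifs at h1 <;> omega
      refine ⟨largeLetters_next_eq h3, ?_⟩
      by_cases hb : HasSmallEnd E ℓ y <;> by_cases hb' : HasSmallEnd E ℓ (next y ε) <;>
        simp only [hb, hb', if_true, if_false] at h1 ⊢ <;> omega
    by_cases hb : HasSmallEnd E ℓ x
    -- For `m > 0` the target exceeds `ℓ`, so it is attained by the coordinate of a large letter.
    · rcases Nat.eq_zero_or_pos m with rfl | hm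
      · refine (hit_le_one hK₁ n x).trans ?_
        norm_num; linarith
      · have hφ : 0 < level E ℓ x := hℓ.trans_le (base_le_level _ _ _)
        refine (hit_letters_le (E := E) (F := largeLetters E ℓ x) (φ := level E ℓ x)
          (fun _ he => (mem_largeLetters.1 he).1) hK₁
          (I := {y | largeLetters E ℓ y = largeLetters E ℓ x ∧ HasSmallEnd E ℓ y}) ?_ ?_ ?_ hφ m ?_
          n x ⟨rfl, hb⟩ ?_).trans ?_
        · rintro y ⟨h1, h2⟩ ε h
          have := hsame y ε h
          exact ⟨this.1.trans h1, this.2.2 h2⟩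
        · exact fun y _ ε => (hK₁K y ε).trans (hKE y ε)
        · rintro y ⟨h1, h2⟩ ε h hmem
          have h3 := h2.winner_lt (hsame y ε h).1
          rw [← h1, mem_largeLetters] at hmem
          linarith [hmem.2]
        · rintro y ⟨h1, -⟩ hy
          have h2 : ℓ < 2 ^ m * level E ℓ x := by
            have h3 : (1 : ℝ) < 2 ^ m := one_lt_pow₀ one_lt_two hm.ne'
            have := base_le_level E ℓ x
            nlinarith
          rcases le_level_iff.1 (show 2 ^ m * level E ℓ x ≤ level E ℓ y from hy) with h | ⟨e, he, h⟩
          · linarith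
          · exact ⟨e, h1 ▸ mem_largeLetters.2 ⟨he, h2.le.trans h⟩, h⟩
        · exact fun z hz => q_le_level (mem_largeLetters.1 hz).1 _ _
        · rw [hA]
          have := const_mul_le_decay hd (show (d : ℝ) ≤ C + d by linarith) (Nat.zero_le θ) m
          simpa using this
    · have hLE : largeLetters E ℓ x ⊂ E := by
        refine (ssubset_iff_of_subset fun _ he => (mem_largeLetters.1 he).1).2 ⟨a, ha, fun h => ?_⟩
        have := (mem_largeLetters.1 h).2
        linarith [hx.2]
      refine ((hW A R hA E hE _ hLE ℓ hℓ).mono_kernel hK₁ ((subMarkov_kernel E).restrict _) hx.1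
        (J := {y | largeLetters E ℓ y = largeLetters E ℓ x ∧ ¬ HasSmallEnd E ℓ y}) ⟨rfl, hb⟩
        ?_ ?_ m n).trans (const_mul_le_decay (by linarith) (by linarith) le_rfl m)
      · rintro y ⟨h1, h2⟩ ε h
        have := hsame y ε h
        exact ⟨this.1.trans h1, fun h3 => h2 (this.2.1 h3)⟩
      · rintro y ⟨h1, h2⟩ ε
        by_cases h : K₁ y ε = 0
        · rw [h]; exact ((subMarkov_kernel E).restrict _).nonneg _ _
        · have h3 := hwin y ε (restrictKernel_ne_zero.1 h).2
          have h4 : y.data.winner ε ∈ largeLetters E ℓ x := by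
            rw [← h1, mem_largeLetters]
            exact ⟨h3, not_lt.1 fun h5 => h2 ⟨ε, h3, h5⟩⟩
          rw [restrictKernel_of (Q := fun (x' : ChainState R) ε => x'.data.winner ε ∈ largeLetters E ℓ x) h4]
          exact (hK₁K y ε).trans (hKE y ε)

/-- Only the loser can move to the left, and only in the row opposite to `ε`. -/
theorem pos_le_pos_next {x : ChainState R} {ε δ : RauzyType} {s : A}
    (hs : δ = ε.opp → s ≠ x.data.loser ε) :
    x.data.pos δ s ≤ (next x ε).data.pos δ s := by
  rcases RauzyType.eq_or_eq_opp ε δ with rfl | rfl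
  · exact (pos_move _ _ _).ge
  · rcases le_or_gt (x.data.pos ε.opp s) (x.data.pos ε.opp (x.data.winner ε)) with h | h
    · exact (pos_move_opp_of_le h).ge
    · have := pos_move_opp_of_lt (hs rfl) h
      change _ ≤ (x.data.move ε).pos ε.opp s
      omega

/-- A loser inserted to the left of `s` would push `s` to the right. -/
theorem pos_lt_pos_winner {x : ChainState R} {ε δ : RauzyType} {s : A}
    (hs : δ = ε.opp → s ≠ x.data.loser ε) (hsw : s ≠ x.data.winner ε)
    (h : (next x ε).data.pos δ s = x.data.pos δ s) :
    x.data.pos δ s < x.data.pos δ (x.data.winner ε) := by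
  have hne : x.data.pos δ s ≠ x.data.pos δ (x.data.winner ε) :=
    fun e => hsw (x.data.pos_injective _ e)
  rcases RauzyType.eq_or_eq_opp ε δ with rfl | rfl
  · exact lt_of_le_of_ne (x.data.pos_le_winner _ _) hne
  · by_contra hc
    have := pos_move_opp_of_lt (hs rfl) (lt_of_le_of_ne (not_lt.1 hc) hne.symm)
    change (x.data.move ε).pos ε.opp s = _ at h
    omega

/-- As `s` is at rest, the winner is to its right, so the loser lands to its right too, where it
already was in the row that changes. -/
theorem pos_lt_pos_next_iff {x : ChainState R} {ε δ : RauzyType} {s e : A}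
    (hs : δ = ε.opp → s ≠ x.data.loser ε) (hsw : s ≠ x.data.winner ε)
    (h : (next x ε).data.pos δ s = x.data.pos δ s) :
    (next x ε).data.pos δ s < (next x ε).data.pos δ e ↔ x.data.pos δ s < x.data.pos δ e := by
  have hlt := pos_lt_pos_winner hs hsw h
  rcases RauzyType.eq_or_eq_opp ε δ with rfl | rfl
  · exact Iff.of_eq (congrArg₂ _ (pos_move _ _ _) (pos_move _ _ _))
  · by_cases he : e = x.data.loser ε
    · have h1 := x.data.pos_opp_loser ε
      have h2 := pos_opp_winner_lt (x.winner_ne ε)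
      have h3 := pos_move_opp_loser (x.winner_ne ε)
      rw [h, he]
      change _ < (x.data.move ε).pos ε.opp _ ↔ _
      omega
    · exact pos_move_opp_lt_iff (hs rfl) he

/-- If `s` loses in the row considered, it lands just after the winner, which is in `E`. Otherwise
the order of `e` and `s` is kept. -/
theorem exists_pos_lt_next {E : Finset A} {x : ChainState R} {ε δ : RauzyType} {s : A}
    (hw : x.data.winner ε ∈ E) (h : ∃ e ∈ E, x.data.pos δ e < x.data.pos δ s) :
    ∃ e ∈ E, (next x ε).data.pos δ e < (next x ε).data.pos δ s := by
  obtain ⟨e, he, hlt⟩ := h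
  rcases RauzyType.eq_or_eq_opp ε δ with rfl | rfl
  · exact ⟨e, he, by simpa only [next, pos_move] using hlt⟩
  · by_cases hs : s = x.data.loser ε
    · refine ⟨_, hw, ?_⟩
      have h1 : (next x ε).data.pos ε.opp (x.data.winner ε) = x.data.pos ε.opp (x.data.winner ε) :=
        pos_move_opp_of_le le_rfl
      have h3 : (next x ε).data.pos ε.opp (x.data.loser ε) = _ :=
        pos_move_opp_loser (x.winner_ne ε)
      rw [hs, h1, h3]
      exact Nat.lt_succ_self _
    · have hel : e ≠ x.data.loser ε := by
        rintro rfl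
        have h1 := x.data.pos_opp_loser ε
        have h2 := x.data.pos_lt ε.opp s
        omega
      exact ⟨e, he, (pos_move_opp_lt_iff hel hs).2 hlt⟩

/-- As soon as all letters of `E` are large, a defeat would raise the coordinate of `s` above `ℓ`.
So `s` never moves to the left in the row `δ`, and while it is at rest only letters to its right
win. These form a proper subset of `E`, because some letter of `E` is to its left. -/
theorem exists_losingLetterDecay {d n : ℕ} {C C₁ : ℝ} {θ θ₁ : ℕ} (hC : 1 ≤ C) (hC₁ : 1 ≤ C₁)
    (hW : WinnersDecay.{u} d n C θ) (hS : SmallLetterDecay.{u} d n C₁ θ₁) :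
    ∃ C' : ℝ, 1 ≤ C' ∧ ∃ θ' : ℕ, LosingLetterDecay.{u} d n C' θ' := by
  classical
  obtain ⟨C', hC', θ', H⟩ := exists_decay_of_phases.{u} (C + C₁) (by linarith) (θ + θ₁) (2 * d)
  refine ⟨C', hC', θ', ?_⟩
  intro A _ _ _ R hA E hE s hs δ ℓ hℓ
  set K := restrictKernel (kernel (R := R) E) fun x ε => (next x ε).q s < ℓ with hKdef
  have hK : SubMarkov K := (subMarkov_kernel E).restrict _
  have hKE : ∀ x ε, K x ε ≤ kernel E x ε := restrictKernel_le (subMarkov_kernel E).nonneg _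
  have hwin : ∀ x ε, K x ε ≠ 0 → x.data.winner ε ∈ E := fun x ε h =>
    winner_mem_of_kernel_ne_zero (restrictKernel_ne_zero.1 h).2
  have hEd : #E ≤ d := hA ▸ card_le_univ E
  have hloser : ∀ x ε, K x ε ≠ 0 → (∀ e ∈ E, ℓ ≤ x.q e) → s ≠ x.data.loser ε := by
    rintro x ε h hall rfl
    have h1 := (restrictKernel_ne_zero.1 h).1
    rw [next_q_loser] at h1
    have := hall _ (hwin x ε h)
    linarith [x.q_pos (x.data.loser ε)]
  have hall_next : ∀ (x : ChainState R) ε, (∀ e ∈ E, ℓ ≤ x.q e) → ∀ e ∈ E, ℓ ≤ (next x ε).q e :=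
    fun x ε h e he => (h e he).trans (x.le_next_q ε e)
  have hcard : ∀ x : ChainState R, (¬ ∀ e ∈ E, ℓ ≤ x.q e) → #(largeLetters E ℓ x) < #E := by
    intro x h
    push Not at h
    obtain ⟨e, he, hlt⟩ := h
    refine card_lt_card ((ssubset_iff_of_subset fun _ he => (mem_largeLetters.1 he).1).2
      ⟨e, he, fun h => ?_⟩)
    linarith [(mem_largeLetters.1 h).2]
  -- While some letter of `E` is small, the index is less than `#E ≤ d`; the shift by `d` places the
  -- later phases above.
  let p : ChainState R → ℕ := fun x =>
    if ∀ e ∈ E, ℓ ≤ x.q e then d + x.data.pos δ s else #(largeLetters E ℓ x)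
  refine H next K _ (level E ℓ) p hK ?_ ?_ ?_ ?_ ?_ ?_
  · exact fun x hx ε h => ⟨hx.1.move (hwin x ε h) (x.winner_ne ε), (restrictKernel_ne_zero.1 h).1,
      exists_pos_lt_next (hwin x ε h) hx.2.2⟩
  · exact fun x _ => hℓ.trans_le (base_le_level _ _ _)
  · exact fun x _ ε h => ⟨level_le_level_next _ _ _ _, level_next_le hℓ.le (hwin x ε h)⟩
  · intro x _ ε h
    dsimp only [p]
    by_cases hall : ∀ e ∈ E, ℓ ≤ x.q e
    · rw [if_pos hall, if_pos (hall_next x ε hall)]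
      have := pos_le_pos_next (x := x) (δ := δ) fun _ => hloser x ε h hall
      omega
    · rw [if_neg hall]
      have h1 := hcard x hall
      split_ifs
      · omega
      · exact card_le_card (largeLetters_subset_next E ℓ x ε)
  · intro x _
    dsimp only [p]
    have h1 := card_largeLetters_le E ℓ x
    have h2 := x.data.pos_lt δ s
    split_ifs <;> omega
  · intro x hx m n
    set K₁ := restrictKernel K fun x ε => p (next x ε) = p x with hK₁def
    have hK₁ : SubMarkov K₁ := hK.restrict _
    have hK₁K : ∀ x ε, K₁ x ε ≤ K x ε := restrictKernel_le hK.nonneg _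
    have hK₁0 : ∀ y ε, K₁ y ε ≠ 0 → K y ε ≠ 0 := fun y ε h => (restrictKernel_ne_zero.1 h).2
    by_cases hall : ∀ e ∈ E, ℓ ≤ x.q e
    · have hpos : ∀ y ε, K₁ y ε ≠ 0 → (∀ e ∈ E, ℓ ≤ y.q e) →
          (next y ε).data.pos δ s = y.data.pos δ s := by
        intro y ε h hy
        have h1 := (restrictKernel_ne_zero.1 h).1
        dsimp only [p] at h1
        rw [if_pos hy, if_pos (hall_next y ε hy)] at h1
        omega
      have hsw : ∀ y ε, K₁ y ε ≠ 0 → s ≠ y.data.winner ε := fun y ε h e =>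
        hs (e ▸ hwin y ε (hK₁0 y ε h))
      let G : ChainState R → Finset A := fun y => {e ∈ E | y.data.pos δ s < y.data.pos δ e}
      have hGE : G x ⊂ E := by
        obtain ⟨e, he, hlt⟩ := hx.2.2
        refine (ssubset_iff_of_subset (filter_subset _ _)).2 ⟨e, he, fun h => ?_⟩
        have := (mem_filter.1 h).2
        omega
      refine ((hW A R hA E hE _ hGE ℓ hℓ).mono_kernel hK₁ ((subMarkov_kernel E).restrict _) hx.1
        (J := {y | (∀ e ∈ E, ℓ ≤ y.q e) ∧ G y = G x}) ⟨hall, rfl⟩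
        ?_ ?_ m n).trans (const_mul_le_decay (by linarith) (by linarith) (by omega) m)
      · rintro y ⟨h1, h2⟩ ε h
        refine ⟨hall_next y ε h1, Eq.trans (filter_congr fun e _ => ?_) h2⟩
        exact pos_lt_pos_next_iff (fun _ => hloser y ε (hK₁0 y ε h) h1) (hsw y ε h) (hpos y ε h h1)
      · rintro y ⟨h1, h2⟩ ε
        by_cases h : K₁ y ε = 0
        · rw [h]; exact ((subMarkov_kernel E).restrict _).nonneg _ _
        · have h4 : y.data.winner ε ∈ G x := by
            rw [← h2]
            exact mem_filter.2 ⟨hwin y ε (hK₁0 y ε h), pos_lt_pos_winner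
              (fun _ => hloser y ε (hK₁0 y ε h) h1) (hsw y ε h) (hpos y ε h h1)⟩
          rw [restrictKernel_of (Q := fun (x' : ChainState R) ε => x'.data.winner ε ∈ G x) h4]
          exact (hK₁K y ε).trans (hKE y ε)
    · obtain ⟨a, ha, hax⟩ : ∃ a ∈ E, x.q a < ℓ := by push Not at hall; exact hall
      have hnot : ∀ y : ChainState R, largeLetters E ℓ y = largeLetters E ℓ x → y.q a < ℓ := by
        intro y hy
        by_contra hc
        have : a ∈ largeLetters E ℓ x := hy ▸ mem_largeLetters.2 ⟨ha, not_lt.1 hc⟩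
        linarith [(mem_largeLetters.1 this).2]
      have hsame : ∀ y ε, largeLetters E ℓ y = largeLetters E ℓ x → K₁ y ε ≠ 0 →
          largeLetters E ℓ (next y ε) = largeLetters E ℓ x := by
        intro y ε hy h
        have hyall : ¬ ∀ e ∈ E, ℓ ≤ y.q e := fun h1 => by linarith [h1 a ha, hnot y hy]
        have h1 := (restrictKernel_ne_zero.1 h).1
        have h2 := hcard y hyall
        dsimp only [p] at h1
        rw [if_neg hyall] at h1
        rw [← hy]
        refine largeLetters_next_eq ?_
        split_ifs at h1 <;> omega
      refine ((hS A R hA E hE a ha ℓ hℓ).mono_kernel hK₁ ((subMarkov_kernel E).restrict _)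
        ⟨hx.1, hax⟩ (J := {y | largeLetters E ℓ y = largeLetters E ℓ x}) rfl
        ?_ ?_ m n).trans (const_mul_le_decay (by linarith) (by linarith) (by omega) m)
      · exact fun y hy ε h => hsame y ε hy h
      · intro y hy ε
        by_cases h : K₁ y ε = 0
        · rw [h]; exact ((subMarkov_kernel E).restrict _).nonneg _ _
        · rw [restrictKernel_of (Q := fun (x : ChainState R) ε => (next x ε).q a < ℓ) (hnot _ (hsame y ε hy h))]
          exact (hK₁K y ε).trans (hKE y ε)

end Estimates

/-! ### Forcing one more letter to lose, and the induction on #E -/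

section Induction

open ChainState CombData

variable {A : Type u} [Fintype A] [DecidableEq A] [Nontrivial A] {R : InvariantData A}

/-- A coordinate outside the set `E` of the letters that can win but inside the larger set `E₁`,
compared for the two kernels. -/
theorem kernel_mul_next_q_le {E E₁ : Finset A} (hE : E ⊆ E₁) {s : A} (hs : s ∈ E₁) (hsE : s ∉ E)
    {x : ChainState R} {ε : RauzyType} (hw : x.data.winner ε ∈ E) :
    kernel E₁ x ε * (next x ε).q s ≤ kernel E x ε * x.q s := by
  have h1 := x.q_pos (x.data.loser ε)
  have h2 := x.q_pos (x.data.winner ε)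
  by_cases hl : s = x.data.loser ε
  · subst hl
    refine (kernel_mul_next_q_loser hs).trans (le_of_eq ?_)
    simp [kernel, hw, hsE]
  · rw [next_q_of_ne x hl]
    refine mul_le_mul_of_nonneg_right ?_ (x.q_pos s).le
    by_cases hlE : x.data.loser ε ∈ E
    · simp [kernel, hw, hE hw, hlE, hE hlE]
    · have : kernel E x ε = 1 := by simp [kernel, hw, hlE]
      rw [this]
      exact kernel_le_one _ _ _

theorem kernel_le_kernel {E E₁ : Finset A} (hE : E ⊆ E₁) {x : ChainState R} {ε : RauzyType}
    (hw : x.data.winner ε ∈ E) : kernel E₁ x ε ≤ kernel E x ε := by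
  by_cases hlE : x.data.loser ε ∈ E
  · simp [kernel, hw, hE hw, hlE, hE hlE]
  · have : kernel E x ε = 1 := by simp [kernel, hw, hlE]
    rw [this]
    exact kernel_le_one _ _ _

/-- If the winners of the transitions of `K` are in `E`, then the probability for `K` is controlled
by those for the kernel in which `s` always loses, weighted by the inverse of the coordinate of
`s`. -/
theorem hit_le_sum_hit {E E₁ : Finset A} (hE : E ⊆ E₁) {s : A} (hs : s ∈ E₁) (hsE : s ∉ E)
    {K : ChainState R → RauzyType → ℝ} (hK : SubMarkov K) {I T : Set (ChainState R)}
    (hI : StableUnder next K I) (hKE : ∀ x ε, K x ε ≤ kernel E₁ x ε)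
    (hw : ∀ x ∈ I, ∀ ε, K x ε ≠ 0 → x.data.winner ε ∈ E) {φ : ℝ} (hφ : 0 < φ) (m n : ℕ)
    (x : ChainState R) (hx : x ∈ I) (hxs : x.q s ≤ φ) :
    hit next K T n x ≤ hit next (kernel E) (T ∩ {y | y.q s < 2 ^ 0 * φ}) n x +
      (1 / 2 ^ m +
        ∑ k ∈ range m, 1 / 2 ^ k * hit next (kernel E) (T ∩ {y | y.q s < 2 ^ (k + 1) * φ}) n x) := by
  have sE := subMarkov_kernel (R := R) E
  let h : ℕ → ℕ → ChainState R → ℝ := fun k n y =>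
    hit next (kernel E) (T ∩ {y | y.q s < 2 ^ k * φ}) n y
  have hh : ∀ k n y, 0 ≤ h k n y := fun k n y => hit_nonneg sE.nonneg n y
  -- On `T`, when the coordinate of `s` is at least `φ`, this dominates `φ / y.q s`: one term for
  -- each dyadic scale below `2 ^ m`, and the constant beyond.
  let W : ℕ → ChainState R → ℝ := fun n y => 1 / 2 ^ m + ∑ k ∈ range m, 1 / 2 ^ k * h (k + 1) n y
  have hterm : ∀ n y, ∀ k ∈ range m, 0 ≤ 1 / 2 ^ k * h (k + 1) n y := fun n y k _ =>
    mul_nonneg (by positivity) (hh _ _ _)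
  have hW : ∀ n y, 0 ≤ W n y := fun n y => add_nonneg (by positivity) (sum_nonneg (hterm n y))
  have hWstep : ∀ n y, ∑ ε, kernel E y ε * W n (next y ε) ≤ W (n + 1) y := by
    intro n y
    have e : ∑ ε, kernel E y ε * W n (next y ε) = (∑ ε, kernel E y ε) * (1 / 2 ^ m) +
        ∑ k ∈ range m, 1 / 2 ^ k * ∑ ε, kernel E y ε * h (k + 1) n (next y ε) := by
      dsimp only [W]
      simp only [mul_add, mul_sum, sum_add_distrib, sum_mul]
      rw [sum_comm (s := range m)]
      congr 1
      exact sum_congr rfl fun ε _ => sum_congr rfl fun k _ => by ring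
    rw [e]
    refine add_le_add (mul_le_of_le_one_left (by positivity) (sE.sum_le y))
      (sum_le_sum fun k _ => mul_le_mul_of_nonneg_left (sum_mul_hit_le sE n y) (by positivity))
  -- A change of measure: the factor `y.q s` turns a mean for `K` into a mean for `kernel E`. The
  -- first term treats the paths that end with the coordinate of `s` below `φ`.
  let V : ℕ → ChainState R → ℝ := fun n y => h 0 n y + y.q s / φ * W n y
  have key : hit next K T n x ≤ V n x := by
    refine hit_le_of_supersolution hK.nonneg hI V ?_ ?_ ?_ n x hx
    · exact fun n y _ => add_nonneg (hh _ _ _)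
        (mul_nonneg (div_nonneg (y.q_pos s).le hφ.le) (hW n y))
    · intro n y _ hyT
      have hq : 0 ≤ y.q s / φ := div_nonneg (y.q_pos s).le hφ.le
      by_cases h0 : y.q s < 2 ^ 0 * φ
      · have : h 0 n y = 1 := hit_of_mem (T := T ∩ {y | y.q s < 2 ^ 0 * φ}) ⟨hyT, h0⟩ n
        dsimp only [V]
        rw [this]
        linarith [mul_nonneg hq (hW n y)]
      · have h1 : 1 ≤ y.q s / φ := by rw [one_le_div hφ]; simpa using h0
        have h2 : 1 ≤ y.q s / φ * W n y := by
          obtain ⟨k, hk1, hk2⟩ := exists_nat_pow_near h1 (one_lt_two (α := ℝ))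
          by_cases hkm : k < m
          · have e : h (k + 1) n y = 1 := by
              refine hit_of_mem (T := T ∩ {y | y.q s < 2 ^ (k + 1) * φ}) ⟨hyT, ?_⟩ n
              rwa [div_lt_iff₀ hφ] at hk2
            have hle : 1 / 2 ^ k ≤ W n y := by
              have := single_le_sum (hterm n y) (mem_range.2 hkm)
              rw [e, mul_one] at this
              dsimp only [W]
              have h3 : (0 : ℝ) ≤ 1 / 2 ^ m := by positivity
              linarith
            calc (1 : ℝ) = 2 ^ k * (1 / 2 ^ k) := by field_simp
              _ ≤ _ := mul_le_mul hk1 hle (by positivity) hq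
          · have hle : 1 / 2 ^ m ≤ W n y := le_add_of_nonneg_right (sum_nonneg (hterm n y))
            calc (1 : ℝ) = 2 ^ m * (1 / 2 ^ m) := by field_simp
              _ ≤ _ := mul_le_mul ((pow_le_pow_right₀ one_le_two (not_lt.1 hkm)).trans hk1) hle
                (by positivity) hq
        exact h2.trans (le_add_of_nonneg_left (hh _ _ _))
    · intro n y hy _
      have h1 : ∀ ε, K y ε * V n (next y ε) ≤ kernel E y ε * h 0 n (next y ε) +
          y.q s / φ * (kernel E y ε * W n (next y ε)) := by
        intro ε
        by_cases hz : K y ε = 0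
        · rw [hz, zero_mul]
          have := sE.nonneg y ε
          exact add_nonneg (mul_nonneg this (hh _ _ _))
            (mul_nonneg (div_nonneg (y.q_pos s).le hφ.le) (mul_nonneg this (hW _ _)))
        · have hwin := hw y hy ε hz
          dsimp only [V]
          rw [mul_add]
          refine add_le_add (mul_le_mul_of_nonneg_right
            ((hKE y ε).trans (kernel_le_kernel hE hwin)) (hh _ _ _)) ?_
          have h2 : K y ε * (next y ε).q s ≤ kernel E y ε * y.q s :=
            (mul_le_mul_of_nonneg_right (hKE y ε) ((next y ε).q_pos s).le).trans
              (kernel_mul_next_q_le hE hs hsE hwin)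
          calc K y ε * ((next y ε).q s / φ * W n (next y ε))
              = K y ε * (next y ε).q s * (W n (next y ε) / φ) := by ring
            _ ≤ kernel E y ε * y.q s * (W n (next y ε) / φ) :=
                mul_le_mul_of_nonneg_right h2 (div_nonneg (hW _ _) hφ.le)
            _ = _ := by ring
      refine (sum_le_sum fun ε _ => h1 ε).trans ?_
      rw [sum_add_distrib, ← mul_sum]
      exact add_le_add (sum_mul_hit_le sE n y)
        (mul_le_mul_of_nonneg_left (hWstep n y) (div_nonneg (y.q_pos s).le hφ.le))
  refine key.trans (add_le_add le_rfl ?_)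
  exact mul_le_of_le_one_left (hW n x) ((div_le_one hφ).2 hxs)

/-- The coordinate of `s` only increases, so it is below `2 ^ k * φ` along the whole path. With this
threshold as base level, only a growth by `2 ^ (m - k)` is required. -/
theorem hit_losing_le {d N : ℕ} {C : ℝ} {θ : ℕ} (hC : 1 ≤ C) (hL : LosingLetterDecay.{u} d N C θ)
    (hA : Fintype.card A = d) {E : Finset A} (hE : #E ≤ N) {s : A} (hs : s ∉ E) {δ : RauzyType}
    {x : ChainState R} (hirr : IrreducibleOn E x.data)
    (hδ : ∃ e ∈ E, x.data.pos δ e < x.data.pos δ s) {φ : ℝ} (hφ : 0 < φ)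
    (hx : ∀ e ∈ E, x.q e ≤ φ) {k m : ℕ} (hkm : k ≤ m) (n : ℕ) :
    hit next (kernel E) ({y | ∃ e ∈ E, 2 ^ m * φ ≤ y.q e} ∩ {y | y.q s < 2 ^ k * φ}) n x ≤
      C * ((m : ℝ) + 1) ^ θ / 2 ^ m * 2 ^ k := by
  have sE := subMarkov_kernel (R := R) E
  have hℓ : 0 < 2 ^ k * φ := by positivity
  have hstable : StableUnder next (kernel (R := R) E) {y | y.q s < 2 ^ k * φ}ᶜ :=
    fun y hy ε _ h => hy (lt_of_le_of_lt (y.le_next_q ε s) h)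
  by_cases hxs : x.q s < 2 ^ k * φ
  · have h1 := hL A R hA E hE s hs δ _ hℓ x ⟨hirr, hxs, hδ⟩ (m - k) n
    have hlev : level E (2 ^ k * φ) x = 2 ^ k * φ := by
      refine le_antisymm (level_le_iff.2 ⟨le_rfl, fun e he => (hx e he).trans ?_⟩)
        (base_le_level _ _ _)
      exact le_mul_of_one_le_left hφ.le (one_le_pow₀ one_le_two)
    have e : (2 : ℝ) ^ m = 2 ^ (m - k) * 2 ^ k := by rw [← pow_add]; congr 1; omega
    refine (hit_le_hit_restrict sE hstable Set.inter_subset_right n x).trans ?_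
    refine (hit_mono (I := Set.univ) (sE.restrict _) (sE.restrict _) (fun _ _ _ _ => trivial)
      (fun _ _ _ => le_rfl) (fun y _ hy => ?_) n x trivial).trans (h1.trans ?_)
    · obtain ⟨e', he', h2⟩ := hy.1
      change 2 ^ (m - k) * level E (2 ^ k * φ) x ≤ level E (2 ^ k * φ) y
      rw [hlev, ← mul_assoc, ← e]
      exact h2.trans (q_le_level he' _ _)
    · have hle : ((m - k : ℕ) : ℝ) ≤ m := by exact_mod_cast Nat.sub_le m k
      rw [e, div_mul_eq_mul_div, mul_div_mul_right _ _ (by positivity)]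
      gcongr
  · rw [hit_eq_zero sE.nonneg hstable (fun y hy h => hy h.2) n x hxs]
    positivity

/-- The subset `E'` of `G` has fewer letters than `E` and contains all winners. The other letters of
`E` are supermartingales; those of `E'` are treated by forcing a letter `s` outside `G` to lose. -/
theorem exists_winnersDecay (d n : ℕ) :
    ∃ C : ℝ, 1 ≤ C ∧ ∃ θ : ℕ, WinnersDecay.{u} d n C θ := by
  induction n with
  | zero =>
    refine ⟨1, le_rfl, 0, fun A _ _ _ R _ E hE G hG => ?_⟩
    rw [Nat.le_zero, card_eq_zero] at hE
    exact absurd (hE ▸ hG) (not_ssubset_empty G)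
  | succ N ih =>
    obtain ⟨C₀, hC₀, θ₀, hW⟩ := ih
    obtain ⟨C₁, hC₁, θ₁, hS⟩ := exists_smallLetterDecay hC₀ hW
    obtain ⟨C, hC, θ, hL⟩ := exists_losingLetterDecay hC₀ hC₁ hW hS
    have hd : (0 : ℝ) ≤ d := Nat.cast_nonneg d
    -- `d` comes from the letters outside `E'`, 1 from the scales beyond `2 ^ m`, `C` from the paths
    -- where `s` stays below `φ`, and `2 * C` from the `m` intermediate scales.
    refine ⟨d + 1 + 3 * C, by linarith, θ + 1, ?_⟩
    intro A _ _ _ R hA E hE G hG ℓ hℓ x hx m n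
    set K := restrictKernel (kernel (R := R) E) fun x ε => x.data.winner ε ∈ G with hKdef
    have hK : SubMarkov K := (subMarkov_kernel E).restrict _
    have hKE : ∀ x ε, K x ε ≤ kernel E x ε := restrictKernel_le (subMarkov_kernel E).nonneg _
    have hwG : ∀ x ε, K x ε ≠ 0 → x.data.winner ε ∈ G := fun x ε h =>
      (restrictKernel_ne_zero.1 h).1
    have hφ : 0 < level E ℓ x := hℓ.trans_le (base_le_level _ _ _)
    rcases Nat.eq_zero_or_pos m with rfl | hm
    · refine (hit_le_one hK n x).trans ?_
      norm_num; linarith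
    have h2m : (1 : ℝ) < 2 ^ m := one_lt_pow₀ one_lt_two hm.ne'
    rcases G.eq_empty_or_nonempty with rfl | hGne
    · rw [hit_eq_zero (I := {x}) hK.nonneg (fun y _ ε h => absurd (hwG y ε h) (notMem_empty _))
        (fun y hy h => ?_) n x rfl]
      · positivity
      · obtain rfl : y = x := hy
        have : 2 ^ m * level E ℓ y ≤ level E ℓ y := h
        nlinarith
    obtain ⟨E', hE'G, hE'ne, hfin, hirr⟩ := exists_isFinal_irreducibleOn x.data hGne
    have hE'E : E' ⊆ E := hE'G.trans hG.subset
    have hE'card : #E' ≤ N := by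
      have := card_lt_card (lt_of_le_of_lt hE'G hG)
      omega
    -- If all letters of `E` outside `G` were to the left of `E'` in both rows, `E'` would be final
    -- in `E`, against irreducibility.
    obtain ⟨s, hsE, hsG, δ, hδ⟩ : ∃ s ∈ E, s ∉ G ∧ ∃ δ, ∃ e ∈ E',
        x.data.pos δ e < x.data.pos δ s := by
      by_contra hcon
      push Not at hcon
      have h1 : IsFinal E E' x.data := by
        intro z hz hzE' y hy ε
        by_cases hzG : z ∈ G
        · exact hfin z hzG hzE' y hy ε
        · exact lt_of_le_of_ne (hcon z hz hzG ε y hy) fun e =>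
            hzE' (x.data.pos_injective _ e ▸ hy)
      have h2 := hx E' hE'E hE'ne h1
      exact hG.not_subset (h2 ▸ hE'G)
    have hsE' : s ∉ E' := fun h => hsG (hE'G h)
    let I : Set (ChainState R) := {y | IsFinal G E' y.data}
    have hI : StableUnder next K I := fun y hy ε h =>
      (isFinal_move_iff hE'ne (hwG y ε h) (y.winner_ne ε)).2 hy
    have hwE' : ∀ y ∈ I, ∀ ε, K y ε ≠ 0 → y.data.winner ε ∈ E' := fun y hy ε h =>
      IsFinal.winner_mem hy hE'ne (hwG y ε h)
    set φ := level E ℓ x with hφdef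
    let T₁ : Set (ChainState R) := {y | ∃ z ∈ E \ E', 2 ^ m * φ ≤ y.q z}
    let T₂ : Set (ChainState R) := {y | ∃ e ∈ E', 2 ^ m * φ ≤ y.q e}
    have hsplit : hit next K {y | 2 ^ m * φ ≤ level E ℓ y} n x ≤
        hit next K T₁ n x + hit next K T₂ n x := by
      refine (hit_mono (I := Set.univ) hK hK (fun _ _ _ _ => trivial) (fun _ _ _ => le_rfl)
        (fun y _ hy => ?_) n x trivial).trans (hit_union_le hK n x)
      have hbase : ℓ < 2 ^ m * φ := by
        have := base_le_level E ℓ x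
        nlinarith
      rcases le_level_iff.1 (show 2 ^ m * φ ≤ level E ℓ y from hy) with h | ⟨e, he, h⟩
      · linarith
      · by_cases heE' : e ∈ E'
        · exact Or.inr ⟨e, heE', h⟩
        · exact Or.inl ⟨e, mem_sdiff.2 ⟨he, heE'⟩, h⟩
    have hb₁ : hit next K T₁ n x ≤ d / 2 ^ m := by
      rw [← hA]
      exact hit_letters_le (E := E) sdiff_subset hK hI (fun y _ => hKE y)
        (fun y hy ε h hmem => (mem_sdiff.1 hmem).2 (hwE' y hy ε h)) hφ m (fun y _ h => h) n x hfin
        fun z hz => q_le_level (mem_sdiff.1 hz).1 _ _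
    have hb₂ := hit_le_sum_hit (T := T₂) hE'E hsE hsE' hK hI hKE hwE' hφ m n x hfin
      (q_le_level hsE _ _)
    have hk : ∀ k ≤ m, hit next (kernel E') (T₂ ∩ {y | y.q s < 2 ^ k * φ}) n x ≤
        C * ((m : ℝ) + 1) ^ θ / 2 ^ m * 2 ^ k := fun k hkm =>
      hit_losing_le hC hL hA hE'card hsE' hirr hδ hφ (fun e he => q_le_level (hE'E he) _ _) hkm n
    -- The gain `2 ^ (-k)` cancels the loss `2 ^ (k + 1)` up to a factor 2, so all scales contribute
    -- equally.
    have hsum : ∑ k ∈ range m, 1 / 2 ^ k *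
        hit next (kernel E') (T₂ ∩ {y | y.q s < 2 ^ (k + 1) * φ}) n x ≤
        m * (2 * (C * ((m : ℝ) + 1) ^ θ / 2 ^ m)) := by
      have := sum_le_card_nsmul (range m) (fun k => 1 / 2 ^ k *
        hit next (kernel E') (T₂ ∩ {y | y.q s < 2 ^ (k + 1) * φ}) n x)
        (2 * (C * ((m : ℝ) + 1) ^ θ / 2 ^ m)) fun k hkm => by
          refine (mul_le_mul_of_nonneg_left (hk (k + 1) (mem_range.1 hkm)) (by positivity)).trans
            (le_of_eq ?_)
          field_simp
          ring
      simpa using this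
    have h0 := hk 0 (Nat.zero_le m)
    rw [pow_zero, mul_one] at h0
    have hm0 : (0 : ℝ) ≤ m := Nat.cast_nonneg m
    have hθ : (1 : ℝ) ≤ ((m : ℝ) + 1) ^ (θ + 1) := one_le_pow₀ (by linarith)
    have hθ' : ((m : ℝ) + 1) ^ θ ≤ ((m : ℝ) + 1) ^ (θ + 1) :=
      pow_le_pow_right₀ (by linarith) (Nat.le_succ θ)
    calc hit next K {y | 2 ^ m * φ ≤ level E ℓ y} n x
        ≤ d / 2 ^ m + (C * ((m : ℝ) + 1) ^ θ / 2 ^ m +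
          (1 / 2 ^ m + m * (2 * (C * ((m : ℝ) + 1) ^ θ / 2 ^ m)))) := by linarith
      _ = (d + 1 + C * ((m : ℝ) + 1) ^ θ + 2 * C * (m * ((m : ℝ) + 1) ^ θ)) / 2 ^ m := by ring
      _ ≤ _ := by
        refine div_le_div_of_nonneg_right ?_ (by positivity)
        have h1 : m * ((m : ℝ) + 1) ^ θ ≤ ((m : ℝ) + 1) ^ (θ + 1) := by
          rw [pow_succ', add_mul]
          have : (0 : ℝ) ≤ ((m : ℝ) + 1) ^ θ := by positivity
          linarith
        have h2 : C * ((m : ℝ) + 1) ^ θ ≤ C * ((m : ℝ) + 1) ^ (θ + 1) :=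
          mul_le_mul_of_nonneg_left hθ' (by linarith)
        have h3 : 2 * C * (m * ((m : ℝ) + 1) ^ θ) ≤ 2 * C * ((m : ℝ) + 1) ^ (θ + 1) :=
          mul_le_mul_of_nonneg_left h1 (by linarith)
        have h4 : (d : ℝ) + 1 ≤ (d + 1) * ((m : ℝ) + 1) ^ (θ + 1) :=
          le_mul_of_one_le_right (by linarith) hθ
        linarith

end Induction

/-! ### From volumes of cells to hitting probabilities -/

section Measure

open ChainState CombData MeasureTheory

variable {A : Type u} [Fintype A] [DecidableEq A] [Nontrivial A] {R : InvariantData A}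

/-- The state reached by following a list of types of arrows. -/
def ChainState.follow : ChainState R → List RauzyType → ChainState R
  | x, [] => x
  | x, ε :: l => (x.next ε).follow l

theorem arrowMatrix_mulVec (π : CombData A) (ε : RauzyType) (q : A → ℝ) :
    (arrowMatrix π ε).mulVec q =
      Function.update q (π.loser ε) (q (π.loser ε) + q (π.winner ε)) := by
  ext ξ
  rw [arrowMatrix, Matrix.transvection, Matrix.add_mulVec, Matrix.one_mulVec, Pi.add_apply,
    Matrix.single_mulVec]
  by_cases h : ξ = π.loser ε
  · subst h; simp
  · simp [h]

theorem arrowMatrix_transpose_mulVec (π : CombData A) (ε : RauzyType) (v : A → ℝ) :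
    (arrowMatrix π ε).transpose.mulVec v =
      Function.update v (π.winner ε) (v (π.winner ε) + v (π.loser ε)) := by
  ext ξ
  rw [arrowMatrix, Matrix.transvection, Matrix.transpose_add, Matrix.transpose_one,
    Matrix.transpose_single, Matrix.add_mulVec, Matrix.one_mulVec, Pi.add_apply,
    Matrix.single_mulVec]
  by_cases h : ξ = π.winner ε
  · subst h; simp
  · simp [h]

theorem arrowMatrix_mulVec_q (x : ChainState R) (ε : RauzyType) :
    (arrowMatrix x.data ε).mulVec x.q = (x.next ε).q := arrowMatrix_mulVec _ _ _

theorem follow_q (x : ChainState R) (l : List RauzyType) :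
    (x.follow l).q = (pathMatrix x.data l).mulVec x.q := by
  induction l generalizing x with
  | nil => simp [follow, pathMatrix]
  | cons ε l ih =>
    rw [follow, ih, pathMatrix, ← Matrix.mulVec_mulVec, arrowMatrix_mulVec_q]
    rfl

/-- The cell of the path of types `l` that starts at `x`. -/
def stateCell (x : ChainState R) (l : List RauzyType) : Set (A → ℝ) :=
  (fun v => (pathMatrix x.data l).transpose.mulVec v) ''
    simplexBelow ((pathMatrix x.data l).mulVec x.q)

theorem stateCell_nil (x : ChainState R) : stateCell x [] = simplexBelow x.q := by
  simp [stateCell, pathMatrix]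

theorem stateCell_cons (x : ChainState R) (ε : RauzyType) (l : List RauzyType) :
    stateCell x (ε :: l) =
      (fun v => (arrowMatrix x.data ε).transpose.mulVec v) '' stateCell (x.next ε) l := by
  rw [stateCell, stateCell, Set.image_image, pathMatrix, ← Matrix.mulVec_mulVec,
    arrowMatrix_mulVec_q]
  simp only [Matrix.transpose_mul, ← Matrix.mulVec_mulVec]
  rfl

theorem image_simplexBelow_subset (x : ChainState R) (ε : RauzyType) :
    (fun v => (arrowMatrix x.data ε).transpose.mulVec v) '' simplexBelow (x.next ε).q ⊆
      simplexBelow x.q := by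
  rintro _ ⟨v, ⟨h1, h2⟩, rfl⟩
  refine ⟨fun ξ => ?_, ?_⟩
  · dsimp only
    rw [arrowMatrix_transpose_mulVec]
    by_cases h : ξ = x.data.winner ε
    · subst h; simpa using add_pos (h1 _) (h1 _)
    · simpa [h] using h1 ξ
  · rw [← arrowMatrix_mulVec_q] at h2
    refine lt_of_eq_of_lt ?_ h2
    change (arrowMatrix x.data ε).transpose.mulVec v ⬝ᵥ x.q =
      v ⬝ᵥ (arrowMatrix x.data ε).mulVec x.q
    rw [Matrix.mulVec_transpose, Matrix.dotProduct_mulVec]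

theorem stateCell_subset (x : ChainState R) (l : List RauzyType) :
    stateCell x l ⊆ simplexBelow x.q := by
  induction l generalizing x with
  | nil => rw [stateCell_nil]
  | cons ε l ih =>
    rw [stateCell_cons]
    exact (Set.image_mono (ih _)).trans (image_simplexBelow_subset x ε)

theorem volume_image_arrowMatrix (x : ChainState R) (ε : RauzyType) (S : Set (A → ℝ)) :
    volume ((fun v => (arrowMatrix x.data ε).transpose.mulVec v) '' S) = volume S := by
  have h := Measure.addHaar_image_linearMap volume
    (Matrix.toLin' (arrowMatrix x.data ε).transpose) S
  have hdet : (arrowMatrix x.data ε).det = 1 :=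
    Matrix.det_transvection_of_ne _ _ (x.winner_ne ε).symm _
  rw [LinearMap.det_toLin', Matrix.det_transpose, hdet, abs_one, ENNReal.ofReal_one, one_mul] at h
  exact h

/-- Contracting the loser's coordinate of λ by the ratio `c` compensates the growth of that
coordinate of q, and the determinant of this contraction is `c`. -/
theorem volume_simplexBelow_next_le (x : ChainState R) (ε : RauzyType) :
    volume (simplexBelow (x.next ε).q) ≤
      ENNReal.ofReal (kernel univ x ε) * volume (simplexBelow x.q) := by
  have h1 := x.q_pos (x.data.loser ε)
  have h2 := x.q_pos (x.data.winner ε)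
  set c := x.q (x.data.loser ε) / (x.q (x.data.loser ε) + x.q (x.data.winner ε)) with hc
  have hc0 : 0 < c := by positivity
  have hk : kernel univ x ε = c := by simp [kernel, hc]
  have hcq : c * (x.next ε).q (x.data.loser ε) = x.q (x.data.loser ε) := by
    rw [next_q_loser, hc, div_mul_cancel₀ _ (by positivity)]
  let D : A → ℝ := Function.update 1 (x.data.loser ε) c
  have hD : ∀ ξ, 0 < D ξ := fun ξ => by
    by_cases h : ξ = x.data.loser ε
    · subst h; simpa [D] using hc0
    · simp [D, h]
  have hDq : ∀ ξ, D ξ * (x.next ε).q ξ = x.q ξ := fun ξ => by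
    by_cases h : ξ = x.data.loser ε
    · subst h; simpa [D] using hcq
    · simp [D, h, next_q_of_ne x h]
  have hsub : simplexBelow (x.next ε).q ⊆
      Matrix.toLin' (Matrix.diagonal D) '' simplexBelow x.q := by
    rintro v ⟨hv1, hv2⟩
    refine ⟨fun ξ => v ξ / D ξ, ⟨fun ξ => div_pos (hv1 ξ) (hD ξ), ?_⟩, ?_⟩
    · refine lt_of_eq_of_lt (sum_congr rfl fun ξ _ => ?_) hv2
      have := (hD ξ).ne'
      rw [← hDq ξ]; field_simp
    · ext ξ
      have := (hD ξ).ne'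
      rw [Matrix.toLin'_apply, Matrix.mulVec_diagonal]
      field_simp
  refine (measure_mono hsub).trans ?_
  rw [Measure.addHaar_image_linearMap, LinearMap.det_toLin', Matrix.det_diagonal, hk]
  have : ∏ ξ, D ξ = c := by
    rw [prod_update_of_mem (mem_univ _)]; simp
  rw [this, abs_of_pos hc0]

theorem volume_simplexBelow_ne_top {q : A → ℝ} (hq : ∀ ξ, 0 < q ξ) :
    volume (simplexBelow q) ≠ ⊤ := by
  refine measure_ne_top_of_subset (s := Set.Icc 0 fun ξ => 1 / q ξ) ?_
    (isCompact_Icc.measure_lt_top (μ := (volume : Measure (A → ℝ)))).ne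
  rintro v ⟨h1, h2⟩
  refine ⟨fun ξ => (h1 ξ).le, fun ξ => ?_⟩
  rw [le_div_iff₀ (hq ξ)]
  exact (single_le_sum (f := fun ξ => v ξ * q ξ)
    (fun ξ _ => (mul_pos (h1 ξ) (hq ξ)).le) (mem_univ ξ)).trans h2.le

/-- The union of the cells of the paths of length at most `n` from `x` that end in `T`. -/
def cellUnion (T : Set (ChainState R)) (n : ℕ) (x : ChainState R) : Set (A → ℝ) :=
  ⋃ l ∈ {l : List RauzyType | l.length ≤ n ∧ x.follow l ∈ T}, stateCell x l

/-- All cells lie in the initial simplex, which settles a start in `T`. Otherwise paths are sorted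
by their first arrow, whose matrix preserves volume. -/
theorem volume_cellUnion_le (T : Set (ChainState R)) (n : ℕ) (x : ChainState R) :
    volume (cellUnion T n x) ≤
      ENNReal.ofReal (hit next (kernel univ) T n x) * volume (simplexBelow x.q) := by
  have sK := subMarkov_kernel (R := R) univ
  induction n generalizing x with
  | zero =>
    by_cases hx : x ∈ T
    · rw [hit_of_mem hx, ENNReal.ofReal_one, one_mul]
      exact measure_mono (Set.iUnion₂_subset fun l _ => stateCell_subset x l)
    · have : cellUnion T 0 x = ∅ := by
        refine Set.subset_empty_iff.1 (Set.iUnion₂_subset fun l hl => ?_)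
        obtain rfl : l = [] := List.length_eq_zero_iff.1 (Nat.le_zero.1 hl.1)
        exact absurd hl.2 hx
      simp [this]
  | succ n ih =>
    by_cases hx : x ∈ T
    · rw [hit_of_mem hx, ENNReal.ofReal_one, one_mul]
      exact measure_mono (Set.iUnion₂_subset fun l _ => stateCell_subset x l)
    · have hsub : cellUnion T (n + 1) x ⊆ ⋃ ε,
          (fun v => (arrowMatrix x.data ε).transpose.mulVec v) '' cellUnion T n (x.next ε) := by
        refine Set.iUnion₂_subset fun l hl => ?_
        cases l with
        | nil => exact absurd hl.2 hx
        | cons ε l =>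
          rw [stateCell_cons]
          refine Set.subset_iUnion_of_subset ε (Set.image_mono ?_)
          exact Set.subset_biUnion_of_mem (u := fun l => stateCell (x.next ε) l)
            (show l ∈ {l | _ ∧ _} from ⟨Nat.succ_le_succ_iff.1 hl.1, hl.2⟩)
      rw [hit_succ_of_notMem hx, ENNReal.ofReal_sum_of_nonneg fun ε _ =>
        mul_nonneg (sK.nonneg _ _) (hit_nonneg sK.nonneg _ _), sum_mul]
      refine (measure_mono hsub).trans ((measure_iUnion_fintype_le _ _).trans
        (sum_le_sum fun ε _ => ?_))
      rw [volume_image_arrowMatrix, ENNReal.ofReal_mul (sK.nonneg _ _),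
        mul_comm (ENNReal.ofReal (kernel univ x ε)), mul_assoc]
      exact (ih _).trans (by gcongr; exact volume_simplexBelow_next_le x ε)

theorem volume_iUnion_stateCell_le {T : Set (ChainState R)} {x : ChainState R} {b : ℝ}
    (hb : ∀ n, hit next (kernel univ) T n x ≤ b) :
    volume (⋃ l ∈ {l : List RauzyType | x.follow l ∈ T}, stateCell x l) ≤
      ENNReal.ofReal b * volume (simplexBelow x.q) := by
  have hmono : Monotone fun n => cellUnion T n x := fun n n' h =>
    Set.biUnion_subset_biUnion_left fun l hl => ⟨hl.1.trans h, hl.2⟩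
  have hsub : (⋃ l ∈ {l : List RauzyType | x.follow l ∈ T}, stateCell x l) ⊆
      ⋃ n, cellUnion T n x := by
    refine Set.iUnion₂_subset fun l hl => Set.subset_iUnion_of_subset l.length ?_
    exact Set.subset_biUnion_of_mem (u := fun l => stateCell x l)
      (show l ∈ {l | _ ∧ _} from ⟨le_rfl, hl⟩)
  refine (measure_mono hsub).trans ?_
  rw [hmono.measure_iUnion]
  exact iSup_le fun n => (volume_cellUnion_le T n x).trans
    (by gcongr; exact hb n)

end Measure

/-! ### Proof of the theorem -/

theorem mainTheorem8 (d : ℕ) :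
    ∃ C : ℝ, 0 < C ∧ ∃ θ : ℝ, 0 < θ ∧
      ∀ (A : Type u) [Fintype A] [DecidableEq A] [Nontrivial A], Fintype.card A = d →
      ∀ R : Set (CombData A), IsRauzyClass R →
      ∀ (A' : Finset A) (hA' : A'.Nonempty), A' ≠ Finset.univ →
      ∀ m M : ℤ, 0 ≤ m → m ≤ M →
      ∀ q : A → ℝ, (∀ ξ, 0 < q ξ) →
      ∀ (π : CombData A) (hπ : π ∈ R),
        RauzyPath.condProb q
            {γ : RauzyPath R |
              (2 : ℝ) ^ M * maxCoord Finset.univ Finset.univ_nonempty q <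
                  maxCoord Finset.univ Finset.univ_nonempty (γ.B.mulVec q) ∧
                maxCoord A' hA' (γ.B.mulVec q) <
                  (2 : ℝ) ^ (M - m) * maxCoord Finset.univ Finset.univ_nonempty q}
            (RauzyPath.trivial π hπ) ≤
          C * ((m : ℝ) + 1) ^ θ * (2 : ℝ) ^ (-m) := by
  obtain ⟨C₀, hC₀, θ₀, hW⟩ := exists_winnersDecay.{u} d d
  obtain ⟨C, hC, θ, hS⟩ := exists_smallLetterDecay hC₀ hW
  -- The increment makes the exponent positive even if `θ = 0`.
  refine ⟨C, by linarith, ((θ + 1 : ℕ) : ℝ), by positivity, ?_⟩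
  intro A _ _ _ hA R hR A' hA' _ m M hm hmM q hq π hπ
  obtain ⟨-, hirr, hmove⟩ := hR.prop
  let S : InvariantData A := ⟨R, hmove, fun π hπ => (hirr π hπ).winner_ne_loser⟩
  let x : ChainState S := ⟨π, hπ, q, hq⟩
  obtain ⟨k, rfl⟩ := Int.eq_ofNat_of_zero_le hm
  set φ := maxCoord univ univ_nonempty q with hφ
  have hle : ∀ ξ, q ξ ≤ φ := fun ξ => le_sup' q (mem_univ ξ)
  obtain ⟨a, ha⟩ := hA'
  have hφ0 : 0 < φ := (hq a).trans_le (hle a)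
  -- Since `k ≤ M`, every initial coordinate is at most `ℓ`: the level starts at `ℓ`, and the target
  -- `2 ^ M * φ` is exactly `2 ^ k * ℓ`.
  set ℓ := (2 : ℝ) ^ (M - k) * φ with hℓ
  have hφℓ : φ ≤ ℓ := le_mul_of_one_le_left hφ0.le
    (one_le_zpow₀ one_le_two (by omega))
  have hℓ0 : 0 < ℓ := hφ0.trans_le hφℓ
  have hkℓ : (2 : ℝ) ^ k * ℓ = (2 : ℝ) ^ M * φ := by
    rw [hℓ, ← mul_assoc, ← zpow_natCast, ← zpow_add₀ two_ne_zero]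
    congr 2; omega
  let T : Set (ChainState S) := {y | (2 : ℝ) ^ M * φ < maxCoord univ univ_nonempty y.q ∧
    maxCoord A' ⟨a, ha⟩ y.q < ℓ}
  have hTa : T ⊆ {y | y.q a < ℓ} := fun y hy => (le_sup' y.q ha).trans_lt hy.2
  have sE := ChainState.subMarkov_kernel (R := S) univ
  have hstable : StableUnder ChainState.next (ChainState.kernel (R := S) univ)
      {y | y.q a < ℓ}ᶜ :=
    fun y hy ε _ h => hy (lt_of_le_of_lt (y.le_next_q ε a) h)
  have hb : ∀ n, hit ChainState.next (ChainState.kernel univ) T n x ≤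
      C * ((k : ℝ) + 1) ^ θ / 2 ^ k := by
    intro n
    by_cases hxa : x.q a < ℓ
    · have h1 := hS A S hA univ (hA ▸ le_rfl) a (mem_univ a) ℓ hℓ0 x
        ⟨(hirr π hπ).irreducibleOn, hxa⟩ k n
      have hlev : ChainState.level univ ℓ x = ℓ :=
        le_antisymm (ChainState.level_le_iff.2 ⟨le_rfl, fun e _ => (hle e).trans hφℓ⟩)
          (ChainState.base_le_level _ _ _)
      refine (hit_le_hit_restrict sE hstable hTa n x).trans (le_trans ?_ h1)
      refine hit_mono (I := Set.univ) (sE.restrict _) (sE.restrict _) (fun _ _ _ _ => trivial)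
        (fun _ _ _ => le_rfl) (fun y _ hy => ?_) n x trivial
      change 2 ^ k * ChainState.level univ ℓ x ≤ ChainState.level univ ℓ y
      rw [hlev, hkℓ]
      exact hy.1.le.trans (sup'_le _ _ fun e he => ChainState.q_le_level he _ _)
    · rw [hit_eq_zero sE.nonneg hstable (fun y hy h => hy (hTa h)) n x hxa]
      positivity
  have hvol := volume_iUnion_stateCell_le hb
  have hfin := volume_simplexBelow_ne_top hq
  have hb0 : (0 : ℝ) ≤ C * ((k : ℝ) + 1) ^ θ / 2 ^ k := by positivity
  have hcell : RauzyPath.cell q (RauzyPath.trivial π hπ) = simplexBelow q := stateCell_nil x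
  have hbound : C * ((k : ℝ) + 1) ^ θ / 2 ^ k ≤
      C * (((k : ℤ) : ℝ) + 1) ^ ((θ + 1 : ℕ) : ℝ) * (2 : ℝ) ^ (-(k : ℤ)) := by
    rw [Real.rpow_natCast, zpow_neg, zpow_natCast, ← div_eq_mul_inv, Int.cast_natCast]
    exact const_mul_le_decay (by linarith) le_rfl (Nat.le_succ θ) k
  refine le_trans ?_ hbound
  refine div_le_of_le_mul₀ ENNReal.toReal_nonneg hb0 ?_
  rw [hcell]
  have hsub : (⋃ γ' ∈ {γ' ∈ {γ : RauzyPath R |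
        (2 : ℝ) ^ M * φ < maxCoord univ univ_nonempty (γ.B.mulVec q) ∧
          maxCoord A' ⟨a, ha⟩ (γ.B.mulVec q) < ℓ} |
        γ'.StartsBy (RauzyPath.trivial π hπ)}, RauzyPath.cell q γ') ⊆
      ⋃ l ∈ {l : List RauzyType | x.follow l ∈ T}, stateCell x l := by
    refine Set.iUnion₂_subset ?_
    rintro ⟨π', hπ', l⟩ ⟨hγ, hstart, -⟩
    obtain rfl : π' = π := hstart
    refine Set.subset_biUnion_of_mem (u := fun l => stateCell x l) (show x.follow l ∈ T from ?_)
    change _ < maxCoord _ _ (x.follow l).q ∧ maxCoord _ _ (x.follow l).q < _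
    rw [follow_q]
    exact hγ
  have h3 := (MeasureTheory.measure_mono hsub).trans hvol
  have h4 := ENNReal.toReal_mono (ENNReal.mul_ne_top ENNReal.ofReal_ne_top hfin) h3
  rwa [ENNReal.toReal_mul, ENNReal.toReal_ofReal hb0] at h4
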